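/- Let $\mathbb{K}$ be an algebraically closed field of characteristic zero, let $\mathbb{G}_m=\mathbb{K}^\times$ be the one-dimensional algebraic torus, and let $X$ be an irreducible normal affine variety over $\mathbb{K}$ equipped with an effective regular action $\mathbb{G}_m\times X\to X$. Let $A=\mathbb{K}[X]=\bigoplus_{i\in\mathbb{Z}}A_i$ be the corresponding grading, where $A_i$ consists of all $f\in A$ with $f(t\cdot x)=t^i f(x)$ for all $t\in\mathbb{G}_m$ and $x\in X$. The action is called parabolic if there is a non-empty open subset $U\subseteq X$ such that the $\mathbb{G}_m$-orbits of points of $U$ are not closed in $X$ and any two distinct such orbits have disjoint closures in $X$. Consider the following conditions. (a) The action is parabolic. (b) There is a prime divisor $D$ in $X$ (an irreducible closed subset of codimension one) that is fixed by $\mathbb{G}_m$ pointwise. (c) The grading has the form $A=\bigoplus_{i\ge 0}A_i$, and the transcendence degree over $\mathbb{K}$ of the subalgebra $A_0=\mathbb{K}[X]^{\mathbb{G}_m}$ equals $\dim X-1$. Then (a) and (b) are equivalent. If moreover $A_i\neq 0$ for some $i>0$ (which can always be achieved by replacing the action with its composition with $t\mapsto t^{-1}$, if necessary), then (a), (b)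 and (c) are equivalent. Finally, every prime divisor $D$ in $X$ that is fixed by $\mathbb{G}_m$ pointwise coincides with the set of all $\mathbb{G}_m$-fixed points of $X$. -/

import Mathlib

/-- The set of points of affine `n`-space over `K`: a synonym of `Fin n → K` that carries the
Zariski topology. -/
def AffSpace (K : Type*) (n : ℕ) : Type _ := Fin n → K

namespace AffSpace

/-- The Zariski topology: the closed sets are the common zero sets of families of polynomials in
`K[x₁, …, xₙ]`. -/
instance zariskiTopology (K : Type*) [Field K] (n : ℕ) : TopologicalSpace (AffSpace K n) :=
  TopologicalSpace.ofClosed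
    {Z | ∃ S : Set (MvPolynomial (Fin n) K),
      Z = {x : AffSpace K n | ∀ p ∈ S, MvPolynomial.eval (x : Fin n → K) p = 0}}
    ⟨{1}, by ext x; simp⟩
    (by
      intro T hT
      refine ⟨{p | ∃ Z ∈ T, ∀ x ∈ Z, MvPolynomial.eval (x : Fin n → K) p = 0}, ?_⟩
      ext x
      constructor
      · rintro hx p ⟨Z, hZ, hp⟩
        exact hp x (hx Z hZ)
      · intro hx Z hZ
        obtain ⟨S, rfl⟩ := hT hZ
        exact fun p hp => hx p ⟨_, hZ, fun y hy => hy p hp⟩)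
    (by
      rintro _ ⟨S, rfl⟩ _ ⟨S', rfl⟩
      refine ⟨{r | ∃ p ∈ S, ∃ q ∈ S', r = p * q}, ?_⟩
      ext x
      constructor
      · rintro (hx | hx) _ ⟨p, hp, q, hq, rfl⟩
        · rw [map_mul, hx p hp, zero_mul]
        · rw [map_mul, hx q hq, mul_zero]
      · intro hx
        by_contra hne
        rw [Set.mem_union, not_or] at hne
        simp only [Set.mem_ofPred_eq, not_forall] at hne
        obtain ⟨⟨p, hp, hpx⟩, q, hq, hqx⟩ := hne
        have := hx (p * q) ⟨p, hp, q, hq, rfl⟩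
        rw [map_mul] at this
        exact (mul_ne_zero hpx hqx) this)

theorem isClosed_iff {K : Type*} [Field K] {n : ℕ} {Z : Set (AffSpace K n)} :
    IsClosed Z ↔ ∃ S : Set (MvPolynomial (Fin n) K),
      Z = {x : AffSpace K n | ∀ p ∈ S, MvPolynomial.eval (x : Fin n → K) p = 0} := by
  rw [← isOpen_compl_iff]
  change Zᶜᶜ ∈ _ ↔ _
  rw [compl_compl]
  rfl

end AffSpace

section Variety

variable {K : Type*} [Field K] {n : ℕ}

/-- The algebra `K[X]` of regular functions on a closed subset `X` of affine space: the functions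
`X → K` that are restrictions of polynomials. -/
noncomputable def coordRing (X : Set (AffSpace K n)) : Subalgebra K (X → K) :=
  (MvPolynomial.aeval (R := K) fun (j : Fin n) (x : X) => (x.1 : Fin n → K) j).range

/-- A prime divisor on the variety `X`: an irreducible closed subset of codimension one.
(For a variety `X`, all dimensions here are finite.) -/
def IsPrimeDivisor {X : Set (AffSpace K n)} (D : Set X) : Prop :=
  IsClosed D ∧ IsIrreducible D ∧ topologicalKrullDim D + 1 = topologicalKrullDim X

variable (X : Set (AffSpace K n)) [MulAction Kˣ X]

/-- The action `𝔾ₘ × X → X` is a morphism of varieties: for every `f ∈ K[X]` the function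
`(t, x) ↦ f (t • x)` lies in `K[𝔾ₘ × X] = K[X][t, t⁻¹]`. -/
def IsRegularAction : Prop :=
  ∀ f ∈ coordRing X, ∃ c : ℤ →₀ coordRing X, ∀ (t : Kˣ) (x : X),
    f (t • x) = c.sum fun i g => ((t ^ i : Kˣ) : K) * g.1 x

/-- The homogeneous component `A_i` of `A = K[X]`: the regular functions `f` such that
`f (t • x) = t ^ i f (x)` for all `t ∈ 𝔾ₘ` and `x ∈ X`. -/
noncomputable def weightSpace (i : ℤ) : Submodule K (coordRing X) where
  carrier := {f | ∀ (t : Kˣ) (x : X), f.1 (t • x) = ((t ^ i : Kˣ) : K) * f.1 x}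
  zero_mem' := fun t x => by simp
  add_mem' := fun {f g} hf hg t x => by
    have h1 := hf t x
    have h2 := hg t x
    simp only [Subalgebra.coe_add, Pi.add_apply, h1, h2, mul_add]
  smul_mem' := fun a f hf t x => by
    have h1 := hf t x
    simp only [SetLike.val_smul, Pi.smul_apply, smul_eq_mul, h1]
    ring

/-- The algebra of invariants `A_0 = K[X]^{𝔾ₘ}`. -/
noncomputable def invariantRing : Subalgebra K (coordRing X) where
  carrier := {f | ∀ (t : Kˣ) (x : X), f.1 (t • x) = f.1 x}
  algebraMap_mem' := fun a t x => rfl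
  add_mem' := fun {f g} hf hg t x => by
    simp only [Subalgebra.coe_add, Pi.add_apply, hf t x, hg t x]
  mul_mem' := fun {f g} hf hg t x => by
    simp only [Subalgebra.coe_mul, Pi.mul_apply, hf t x, hg t x]

theorem invariantRing_toSubmodule :
    Subalgebra.toSubmodule (invariantRing X) = weightSpace X 0 := by
  apply Submodule.ext
  intro f
  simp [invariantRing, weightSpace]

/-- The action is parabolic: there is a non-empty open subset `U` such that the orbits of points
of `U` are not closed in `X`, and the closures in `X` of two different such orbits are disjoint. -/
def IsParabolic : Prop :=
  ∃ U : Set X, IsOpen U ∧ U.Nonempty ∧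
    (∀ x ∈ U, ¬ IsClosed (MulAction.orbit Kˣ x)) ∧
    ∀ x ∈ U, ∀ y ∈ U, MulAction.orbit Kˣ x ≠ MulAction.orbit Kˣ y →
      Disjoint (closure (MulAction.orbit Kˣ x)) (closure (MulAction.orbit Kˣ y))

/-- The subset `D` is fixed pointwise by `𝔾ₘ`. -/
def IsPointwiseFixed {X : Set (AffSpace K n)} [MulAction Kˣ X] (D : Set X) : Prop :=
  ∀ x ∈ D, ∀ t : Kˣ, t • x = x

/-- The grading has the form `A = ⨁_{i ≥ 0} A_i`, and the transcendence degree of `A_0` over `K`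
equals `dim X - 1`. -/
def HasNonnegGradingOfCorankOne : Prop :=
  DirectSum.IsInternal (fun i : ℕ => weightSpace X (i : ℤ)) ∧
    ((Cardinal.toENat (Algebra.trdeg K (invariantRing X)) : ℕ∞) : WithBot ℕ∞) + 1 =
      topologicalKrullDim X

end Variety

-- Each condition is compared with one algebraic statement: nonzero regular functions never have
-- opposite nonzero weights (`IsSemidefinite`), and `trdeg A₀ + 1 = trdeg A`. Effectiveness always
-- gives a nonzero function of nonzero weight. It is transcendental over `A₀`, so `trdeg A₀ + 1 ≤
-- trdeg A`.
--
-- Fixed divisors. Functions of nonzero weight vanish at fixed points, so `A₀ → K[D]` is onto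
-- whenever `D` is fixed pointwise. If `D` is a divisor, comparing transcendence degrees makes this
-- map injective. A product of functions of opposite nonzero weights is an invariant vanishing on
-- `D`, hence zero; and a function vanishing on `D` has zero invariant part, so it vanishes at every
-- fixed point and `D` is the whole fixed locus. Conversely, for a semidefinite grading the
-- projection `A → A₀` is an algebra map; composed with evaluation at `x` it gives a fixed point in
-- the closure of the orbit of `x`. The fixed locus then has coordinate ring `A₀`, and so is a
-- divisor.
--
-- Parabolic implies algebraic. If nonzero functions have opposite nonzero weights, orbits where
-- both are nonzero are closed (`isClosed_orbit_of_opposite_weights`). If `trdeg A` over `A₀`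
-- exceeded one, Chevalley's theorem would give points of `U` with equal invariants and equal
-- nonzero value of some weight function `f`, on which another function takes infinitely many
-- values. These points share a limit, so they lie on one orbit, where `f` leaves only finitely many
-- of them.
--
-- Algebraic implies parabolic. Limit points make generic orbits non-closed. Normality shows that a
-- ratio of functions of equal weight is a ratio of invariants (`exists_invariant_ratio`), so
-- invariants separate generic orbits; being constant on orbit closures, they keep those closures
-- disjoint.

universe u

/-! ### Nullstellensatz, Chevalley's theorem, dimension and transcendence degree. -/

section CommutativeAlgebra

theorem exists_algHom_ker_eq_of_isMaximal {K S : Type*} [Field K] [IsAlgClosed K] [CommRing S]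
    [Algebra K S] [Algebra.FiniteType K S] (I : Ideal S) [hI : I.IsMaximal] :
    ∃ χ : S →ₐ[K] K, RingHom.ker χ = I := by
  let : Field (S ⧸ I) := Ideal.Quotient.field I
  have : Algebra.FiniteType K (S ⧸ I) :=
    Algebra.FiniteType.of_surjective (Ideal.Quotient.mkₐ K I) (Ideal.Quotient.mkₐ_surjective K I)
  have : Module.Finite K (S ⧸ I) := finite_of_finite_type_of_isJacobsonRing K (S ⧸ I)
  have hb : Function.Bijective (algebraMap K (S ⧸ I)) :=
    IsAlgClosed.algebraMap_bijective_of_isIntegral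
  let e : K ≃ₐ[K] (S ⧸ I) := AlgEquiv.ofBijective (Algebra.ofId K (S ⧸ I)) hb
  refine ⟨(e.symm : (S ⧸ I) →ₐ[K] K).comp (Ideal.Quotient.mkₐ K I), ?_⟩
  ext s
  simp [RingHom.mem_ker, Ideal.Quotient.eq_zero_iff_mem]

theorem AlgHom.eq_of_ker_le {K R : Type*} [Field K] [CommRing R] [Algebra K R]
    {φ ψ : R →ₐ[K] K} (h : RingHom.ker φ ≤ RingHom.ker ψ) : φ = ψ := by
  ext r
  have h1 : r - algebraMap K R (φ r) ∈ RingHom.ker φ := by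
    simp [RingHom.mem_ker]
  have h2 := h h1
  rw [RingHom.mem_ker, map_sub, AlgHom.commutes, sub_eq_zero] at h2
  exact h2.symm

/-- The piece `V(g) \ V(f)` containing the generic point of a domain must have `g = 0`, so it is the
basic open set of `f`. -/
theorem PrimeSpectrum.exists_basicOpen_subset_of_isConstructible {R : Type*} [CommRing R]
    [IsDomain R] {s : Set (PrimeSpectrum R)} (hs : Topology.IsConstructible s) (h : ⊥ ∈ s) :
    ∃ u : R, u ≠ 0 ∧ ∀ p : PrimeSpectrum R, u ∉ p.asIdeal → p ∈ s := by
  obtain ⟨C, rfl⟩ := PrimeSpectrum.exists_constructibleSetData_iff.mpr hs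
  simp only [ConstructibleSetData.toSet, Set.mem_iUnion] at h
  obtain ⟨D, hD, hg, hf⟩ := h
  refine ⟨D.f, fun h0 => hf (by simp [h0]), fun p hp => ?_⟩
  simp only [ConstructibleSetData.toSet, Set.mem_iUnion]
  refine ⟨D, hD, ?_, fun h0 => hp (by simpa [PrimeSpectrum.mem_zeroLocus] using h0)⟩
  rw [PrimeSpectrum.mem_zeroLocus] at hg ⊢
  intro x hx
  have h1 : x ∈ (⊥ : PrimeSpectrum R).asIdeal := hg hx
  have h2 : x = 0 := by simpa using h1
  simp [h2]

/-- By Chevalley, the image of `Spec S_v` in `Spec R` is constructible; by injectivity it contains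
the generic point, hence a basic open set. Closed points of the fibres are `K`-points by the
Nullstellensatz. -/
theorem exists_forall_extend_algHom {K R S : Type*} [Field K] [IsAlgClosed K] [CommRing R]
    [IsDomain R] [IsNoetherianRing R] [CommRing S] [IsDomain S] [Algebra K R] [Algebra K S]
    [Algebra.FiniteType K S] (φ : R →ₐ[K] S) (hφ : Function.Injective φ) {v : S} (hv : v ≠ 0) :
    ∃ u : R, u ≠ 0 ∧ ∀ ψ : R →ₐ[K] K, ψ u ≠ 0 →
      ∃ χ : S →ₐ[K] K, χ.comp φ = ψ ∧ χ v ≠ 0 := by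
  let T := Localization.Away v
  have : IsDomain T := IsLocalization.isDomain_localization
    (powers_le_nonZeroDivisors_of_noZeroDivisors hv)
  have : Algebra.FiniteType S T := IsLocalization.finiteType_of_monoid_fg (Submonoid.powers v) T
  have : Algebra.FiniteType K T := Algebra.FiniteType.trans (S := S) inferInstance inferInstance
  let ι : S →ₐ[K] T := IsScalarTower.toAlgHom K S T
  have hι : Function.Injective ι := IsLocalization.injective T
    (powers_le_nonZeroDivisors_of_noZeroDivisors hv)
  let f : R →ₐ[K] T := ι.comp φ
  have hf : Function.Injective f := hι.comp hφ
  have hft : (f : R →+* T).FiniteType := by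
    have h1 : ((f : R →+* T).comp (algebraMap K R)).FiniteType := by
      have : (f : R →+* T).comp (algebraMap K R) = algebraMap K T := f.comp_algebraMap
      rw [this]
      exact RingHom.finiteType_algebraMap.mpr inferInstance
    exact RingHom.FiniteType.of_comp_finiteType h1
  have hfp : (f : R →+* T).FinitePresentation := RingHom.FinitePresentation.of_finiteType.mp hft
  obtain ⟨u, hu, H⟩ := PrimeSpectrum.exists_basicOpen_subset_of_isConstructible
    (PrimeSpectrum.isConstructible_range_comap hfp) (by
      refine ⟨⊥, ?_⟩
      ext r
      simpa using map_eq_zero_iff f hf)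
  refine ⟨u, hu, fun ψ hψ => ?_⟩
  have : (RingHom.ker ψ).IsMaximal := RingHom.ker_isMaximal_of_surjective ψ
    (fun c => ⟨algebraMap K R c, by simp⟩)
  obtain ⟨q, hq⟩ := H ⟨RingHom.ker ψ, inferInstance⟩ hψ
  obtain ⟨n, hn, hqn⟩ := q.asIdeal.exists_le_maximal q.2.ne_top
  obtain ⟨χ, hχ⟩ := exists_algHom_ker_eq_of_isMaximal (K := K) n
  refine ⟨χ.comp ι, ?_, ?_⟩
  · symm
    apply AlgHom.eq_of_ker_le
    intro r hr
    have h1 : r ∈ (PrimeSpectrum.comap (f : R →+* T) q).asIdeal := by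
      rw [hq]; exact hr
    have h2 : f r ∈ n := hqn h1
    rw [← hχ] at h2
    exact h2
  · have h1 : IsUnit (ι v) := IsLocalization.Away.algebraMap_isUnit v
    exact (h1.map χ).ne_zero

/-- Going up lifts chains of primes to `S`; incomparability keeps contracted chains strict. -/
theorem ringKrullDim_eq_of_isIntegral {R S : Type*} [CommRing R] [CommRing S]
    [Algebra R S] [Algebra.IsIntegral R S] (h : Function.Injective (algebraMap R S)) :
    ringKrullDim R = ringKrullDim S := by
  have := (faithfulSMul_iff_algebraMap_injective R S).mpr h
  apply le_antisymm
  · rw [ringKrullDim, Order.krullDim, iSup_le_iff]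
    intro l
    obtain ⟨P, hP⟩ := Algebra.IsIntegral.comap_surjective R S l.head
    have : P.asIdeal.LiesOver l.head.asIdeal := ⟨by rw [← hP]; rfl⟩
    obtain ⟨L, hL, -⟩ := Ideal.exists_ltSeries_of_hasGoingUp l P.asIdeal
    rw [← hL]
    exact Order.LTSeries.length_le_krullDim L
  · refine Order.krullDim_le_of_strictMono (PrimeSpectrum.comap (algebraMap R S)) ?_
    intro P Q hPQ
    exact Ideal.comap_lt_comap_of_integral_mem_sdiff (I := P.asIdeal) (J := Q.asIdeal) hPQ.le
      (Set.exists_of_ssubset hPQ).choose_spec (Algebra.IsIntegral.isIntegral _)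

/-- Noether normalization reduces both sides to a polynomial ring. -/
theorem ringKrullDim_eq_trdeg (K : Type*) {S : Type _} [Field K] [CommRing S] [IsDomain S]
    [Algebra K S] [Algebra.FiniteType K S] :
    ringKrullDim S = ((Cardinal.toENat (Algebra.trdeg K S) : ℕ∞) : WithBot ℕ∞) := by
  obtain ⟨s, g, hg, hint⟩ := exists_integral_inj_algHom_of_fg K S
  let := g.toRingHom.toAlgebra
  have : IsScalarTower K (MvPolynomial (Fin s) K) S :=
    IsScalarTower.of_algebraMap_eq fun x => (g.commutes x).symm
  have : Algebra.IsIntegral (MvPolynomial (Fin s) K) S := ⟨hint⟩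
  have : FaithfulSMul (MvPolynomial (Fin s) K) S :=
    (faithfulSMul_iff_algebraMap_injective _ _).mpr hg
  rw [← ringKrullDim_eq_of_isIntegral (R := MvPolynomial (Fin s) K) hg]
  have h := lift_trdeg_add_eq K (MvPolynomial (Fin s) K) S
  rw [trdeg_eq_zero (R := MvPolynomial (Fin s) K) (A := S), MvPolynomial.trdeg_of_isDomain] at h
  have h' := congrArg Cardinal.toENat h
  simp at h'
  simp [← h']

/-- A transcendence basis of `S` lifts to one of `R`, by the count of elements. A nonzero kernel
would then meet the subalgebra generated by the lift, on which `φ` is injective. -/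
theorem AlgHom.injective_of_trdeg_le {K : Type*} {R S : Type u} [Field K] [CommRing R]
    [IsDomain R] [CommRing S] [IsDomain S] [Algebra K R] [Algebra K S] (φ : R →ₐ[K] S)
    (hφ : Function.Surjective φ) (hfin : Algebra.trdeg K R < Cardinal.aleph0)
    (hle : Algebra.trdeg K R ≤ Algebra.trdeg K S) : Function.Injective φ := by
  obtain ⟨s, hs⟩ := exists_isTranscendenceBasis K S
  let x : s → R := fun i => (hφ i.1).choose
  have hx : φ ∘ x = Subtype.val := funext fun i => (hφ i.1).choose_spec
  have hind : AlgebraicIndependent K x := .of_comp φ (by rw [hx]; exact hs.1)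
  have hbasis : IsTranscendenceBasis K x := hind.isTranscendenceBasis_of_trdeg_le hfin
    (hle.trans_eq hs.cardinalMk_eq_trdeg.symm)
  have halg : Algebra.IsAlgebraic (Algebra.adjoin K (Set.range x)) R := hbasis.isAlgebraic
  have hinj : ∀ a ∈ Algebra.adjoin K (Set.range x), φ a = 0 → a = 0 := by
    intro a ha h0
    rw [Algebra.adjoin_range_eq_range_aeval] at ha
    obtain ⟨p, rfl⟩ := ha
    have h1 : MvPolynomial.aeval (φ ∘ x) p = 0 := by
      have h2 := MvPolynomial.comp_aeval_apply (R := K) x φ p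
      exact h2.symm.trans h0
    rw [hx] at h1
    simp [hs.1.eq_zero_of_aeval_eq_zero p h1]
  rw [injective_iff_map_eq_zero]
  intro a ha
  by_contra hne
  refine Ideal.comap_ne_bot_of_algebraic_mem (R := Algebra.adjoin K (Set.range x))
    (I := RingHom.ker φ) hne ha (halg.isAlgebraic a) ?_
  rw [eq_bot_iff]
  intro b hb
  exact Subtype.ext (hinj b.1 b.2 hb)

end CommutativeAlgebra

/-! ### Dictionary between closed subsets of `X` and ideals of `K[X]`. -/

section RegularFunctions

variable {K : Type u} [Field K] {n : ℕ}

/-- The coordinate functions on a subset of affine space. -/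
noncomputable def coordFun (X : Set (AffSpace K n)) (j : Fin n) : coordRing X :=
  ⟨fun x => (x.1 : Fin n → K) j, MvPolynomial.X j, by simp⟩

/-- The restriction of polynomials to a subset of affine space. -/
noncomputable def polyRestrict (X : Set (AffSpace K n)) :
    MvPolynomial (Fin n) K →ₐ[K] coordRing X :=
  MvPolynomial.aeval (coordFun X)

theorem polyRestrict_eq_aeval (X : Set (AffSpace K n)) (p : MvPolynomial (Fin n) K) :
    (polyRestrict X p).1 = MvPolynomial.aeval (fun j (x : X) => (x.1 : Fin n → K) j) p :=
  MvPolynomial.comp_aeval_apply (coordFun X) (coordRing X).val p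

theorem polyRestrict_apply (X : Set (AffSpace K n)) (p : MvPolynomial (Fin n) K) (x : X) :
    (polyRestrict X p).1 x = MvPolynomial.eval (x.1 : Fin n → K) p := by
  rw [polyRestrict_eq_aeval]
  exact (MvPolynomial.comp_aeval_apply (R := K) (fun j (x : X) => (x.1 : Fin n → K) j)
    (Pi.evalAlgHom K (fun _ : X => K) x) p).trans
    (DFunLike.congr_fun (MvPolynomial.coe_aeval_eq_eval (x.1 : Fin n → K)) p)

theorem polyRestrict_surjective (X : Set (AffSpace K n)) :
    Function.Surjective (polyRestrict X) := by
  rintro ⟨_, p, rfl⟩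
  exact ⟨p, Subtype.ext (polyRestrict_eq_aeval X p)⟩

instance coordRing.finiteType (X : Set (AffSpace K n)) : Algebra.FiniteType K (coordRing X) :=
  Algebra.FiniteType.of_surjective (polyRestrict X) (polyRestrict_surjective X)

instance coordRing.isNoetherianRing (X : Set (AffSpace K n)) : IsNoetherianRing (coordRing X) :=
  Algebra.FiniteType.isNoetherianRing K _

/-- Evaluation of regular functions at a point. -/
noncomputable def evalAt {X : Set (AffSpace K n)} (x : X) : coordRing X →ₐ[K] K :=
  (Pi.evalAlgHom K (fun _ : X => K) x).comp (coordRing X).val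

@[simp]
theorem evalAt_apply {X : Set (AffSpace K n)} (x : X) (f : coordRing X) : evalAt x f = f.1 x := rfl

theorem coordRing_ext {X : Set (AffSpace K n)} {f g : coordRing X} (h : ∀ x, f.1 x = g.1 x) :
    f = g :=
  Subtype.ext (funext h)

theorem coordRing_exists_ne {X : Set (AffSpace K n)} {f : coordRing X} (h : f ≠ 0) :
    ∃ x, f.1 x ≠ 0 := by
  by_contra! h'
  exact h (coordRing_ext h')

/-- The values of `χ` on the coordinates form a point satisfying the equations of `X`. -/
theorem exists_evalAt_eq {X : Set (AffSpace K n)} (hX : IsClosed X) (χ : coordRing X →ₐ[K] K) :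
    ∃ x : X, ∀ f : coordRing X, χ f = f.1 x := by
  obtain ⟨S, hS⟩ := AffSpace.isClosed_iff.mp hX
  let y : AffSpace K n := fun j => χ (coordFun X j)
  have hy : ∀ p, χ (polyRestrict X p) = MvPolynomial.eval (y : Fin n → K) p := by
    intro p
    rw [← MvPolynomial.coe_aeval_eq_eval]
    exact MvPolynomial.comp_aeval_apply (coordFun X) χ p
  have hyX : y ∈ X := by
    rw [hS]
    intro p hp
    rw [← hy]
    have : polyRestrict X p = 0 := coordRing_ext fun x => by
      have hx : x.1 ∈ {x : AffSpace K n | ∀ p ∈ S, MvPolynomial.eval (x : Fin n → K) p = 0} := by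
        rw [← hS]; exact x.2
      rw [polyRestrict_apply, hx p hp]; rfl
    rw [this, map_zero]
  refine ⟨⟨y, hyX⟩, fun f => ?_⟩
  obtain ⟨p, rfl⟩ := polyRestrict_surjective X f
  rw [hy, polyRestrict_apply]

theorem eq_of_forall_coordFun {X : Set (AffSpace K n)} {x y : X}
    (h : ∀ j, (coordFun X j).1 x = (coordFun X j).1 y) : x = y :=
  Subtype.ext (funext h)

theorem isClosed_iff_forall_coordRing {X : Set (AffSpace K n)} {Z : Set X} :
    IsClosed Z ↔ ∀ y, (∀ f : coordRing X, (∀ x ∈ Z, f.1 x = 0) → f.1 y = 0) → y ∈ Z := by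
  constructor
  · intro hZ y hy
    obtain ⟨W, hW, rfl⟩ := isClosed_induced_iff.mp hZ
    obtain ⟨S, rfl⟩ := AffSpace.isClosed_iff.mp hW
    intro p hp
    have := hy (polyRestrict X p) fun x hx => by rw [polyRestrict_apply]; exact hx p hp
    rwa [polyRestrict_apply] at this
  · intro h
    rw [isClosed_induced_iff]
    refine ⟨_, AffSpace.isClosed_iff.mpr
      ⟨{p | ∀ x ∈ Z, MvPolynomial.eval (x.1 : Fin n → K) p = 0}, rfl⟩, ?_⟩
    ext y
    constructor
    · intro hy
      refine h y fun f hf => ?_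
      obtain ⟨p, rfl⟩ := polyRestrict_surjective X f
      rw [polyRestrict_apply]
      exact hy p fun x hx => by rw [← polyRestrict_apply]; exact hf x hx
    · exact fun hy p hp => hp y hy

theorem isClosed_zeros {X : Set (AffSpace K n)} (S : Set (coordRing X)) :
    IsClosed {x : X | ∀ f ∈ S, f.1 x = 0} :=
  isClosed_iff_forall_coordRing.mpr fun _ hy f hf => hy f fun _ hx => hx f hf

theorem mem_closure_iff_forall_coordRing {X : Set (AffSpace K n)} {Z : Set X} {y : X} :
    y ∈ closure Z ↔ ∀ f : coordRing X, (∀ x ∈ Z, f.1 x = 0) → f.1 y = 0 := by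
  constructor
  · intro hy f hf
    have := closure_minimal (t := {x : X | ∀ g ∈ ({f} : Set (coordRing X)), g.1 x = 0})
      (fun x hx g hg => by rw [Set.mem_singleton_iff.mp hg]; exact hf x hx) (isClosed_zeros _) hy
    exact this f rfl
  · intro h
    exact isClosed_iff_forall_coordRing.mp isClosed_closure y fun f hf =>
      h f fun x hx => hf x (subset_closure hx)

theorem isOpen_ne_zero {X : Set (AffSpace K n)} (f : coordRing X) :
    IsOpen {x : X | f.1 x ≠ 0} := by
  have := (isClosed_zeros ({f} : Set (coordRing X))).isOpen_compl
  convert! this using 1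
  ext; simp

theorem exists_basicOpen_subset {X : Set (AffSpace K n)} {U : Set X} (hU : IsOpen U) {x : X}
    (hx : x ∈ U) : ∃ f : coordRing X, f.1 x ≠ 0 ∧ ∀ y, f.1 y ≠ 0 → y ∈ U := by
  have h1 := isClosed_iff_forall_coordRing.mp hU.isClosed_compl x
  by_contra! h
  refine h1 (fun f hf => ?_) hx
  by_contra hfx
  obtain ⟨y, hy, hyU⟩ := h f hfx
  exact hy (hf y hyU)

theorem coordRing_isDomain {X : Set (AffSpace K n)} (hX : IsIrreducible X) :
    IsDomain (coordRing X) := by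
  have hX' : IrreducibleSpace X := isIrreducible_iff_irreducibleSpace.mp hX
  have : Nontrivial (coordRing X) := by
    obtain ⟨x⟩ := hX'.toNonempty
    exact (evalAt x).toRingHom.domain_nontrivial
  have : NoZeroDivisors (coordRing X) := by
    refine ⟨fun {f g} h => ?_⟩
    by_contra! hne
    obtain ⟨x, hx⟩ := coordRing_exists_ne hne.1
    obtain ⟨y, hy⟩ := coordRing_exists_ne hne.2
    obtain ⟨z, hzf, hzg⟩ := nonempty_preirreducible_inter (isOpen_ne_zero f) (isOpen_ne_zero g)
      ⟨x, hx⟩ ⟨y, hy⟩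
    exact mul_ne_zero hzf hzg (congrFun (congrArg Subtype.val h) z)
  exact NoZeroDivisors.to_isDomain _

/-- The ideal of regular functions vanishing on a subset. -/
noncomputable def vanishingIdealOn {X : Set (AffSpace K n)} (Z : Set X) : Ideal (coordRing X) where
  carrier := {f | ∀ x ∈ Z, f.1 x = 0}
  zero_mem' := fun _ _ => rfl
  add_mem' := fun {f g} hf hg x hx => by simp [hf x hx, hg x hx]
  smul_mem' := fun c f hf x hx => by simp [hf x hx]

@[simp]
theorem mem_vanishingIdealOn {X : Set (AffSpace K n)} {Z : Set X} {f : coordRing X} :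
    f ∈ vanishingIdealOn Z ↔ ∀ x ∈ Z, f.1 x = 0 := Iff.rfl

theorem isIrreducible_iff_vanishingIdealOn_isPrime {X : Set (AffSpace K n)} {Z : Set X} :
    IsIrreducible Z ↔ (vanishingIdealOn Z).IsPrime := by
  constructor
  · intro hZ
    refine ⟨?_, fun {f g} h => ?_⟩
    · rw [Ideal.ne_top_iff_one]
      obtain ⟨x, hx⟩ := hZ.nonempty
      exact fun h => one_ne_zero (h x hx)
    · have := isPreirreducible_iff_isClosed_union_isClosed.mp hZ.isPreirreducible _ _
        (isClosed_zeros {f}) (isClosed_zeros {g}) (fun x hx => by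
          simpa using mul_eq_zero.mp (h x hx))
      simpa [Set.subset_def] using this
  · intro h
    constructor
    · by_contra hne
      rw [Set.not_nonempty_iff_eq_empty] at hne
      exact h.ne_top (by rw [Ideal.eq_top_iff_one]; simp [hne])
    · rw [isPreirreducible_iff_isClosed_union_isClosed]
      intro z₁ z₂ h₁ h₂ hsub
      by_contra! hne
      obtain ⟨⟨x, hx, hx1⟩, ⟨y, hy, hy2⟩⟩ := And.imp Set.not_subset.mp Set.not_subset.mp hne
      obtain ⟨f, hfx, hf⟩ := exists_basicOpen_subset h₁.isOpen_compl hx1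
      obtain ⟨g, hgy, hg⟩ := exists_basicOpen_subset h₂.isOpen_compl hy2
      have hfg : f * g ∈ vanishingIdealOn Z := by
        intro z hz
        by_contra hne
        have hne' : f.1 z * g.1 z ≠ 0 := hne
        rcases hsub hz with hz | hz
        · exact hf z (left_ne_zero_of_mul hne') hz
        · exact hg z (right_ne_zero_of_mul hne') hz
      rcases h.mem_or_mem hfg with hf' | hg'
      · exact hfx (hf' x hx)
      · exact hgy (hg' y hy)

/-- Finitely generated algebras are Jacobson, so `P` is an intersection of maximal ideals, and these
are the ideals of points. -/
theorem vanishingIdealOn_zeros [IsAlgClosed K] {X : Set (AffSpace K n)} (hX : IsClosed X)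
    (P : Ideal (coordRing X)) [hP : P.IsPrime] :
    vanishingIdealOn {x : X | ∀ f ∈ P, f.1 x = 0} = P := by
  apply le_antisymm
  · intro f hf
    have : IsJacobsonRing (coordRing X) := isJacobsonRing_of_finiteType (A := K)
    have h1 : P.jacobson = P := IsJacobsonRing.out' P hP.isRadical
    rw [← h1, Ideal.jacobson, Ideal.mem_sInf]
    rintro m ⟨hPm, hm⟩
    obtain ⟨χ, hχ⟩ := exists_algHom_ker_eq_of_isMaximal (K := K) m
    obtain ⟨x, hx⟩ := exists_evalAt_eq hX χ
    rw [← hχ, RingHom.mem_ker, hx]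
    refine hf x fun g hg => ?_
    rw [← hx, ← RingHom.mem_ker, hχ]
    exact hPm hg
  · exact fun f hf x hx => hx f hf

theorem zeros_vanishingIdealOn {X : Set (AffSpace K n)} {Z : Set X} (hZ : IsClosed Z) :
    {x : X | ∀ f ∈ vanishingIdealOn Z, f.1 x = 0} = Z :=
  Set.Subset.antisymm (isClosed_iff_forall_coordRing.mp hZ) fun _ hx _ hf => hf _ hx

theorem topologicalKrullDim_eq_ringKrullDim [IsAlgClosed K] {X : Set (AffSpace K n)}
    (hX : IsClosed X) : topologicalKrullDim X = ringKrullDim (coordRing X) := by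
  let e : TopologicalSpace.IrreducibleCloseds X ≃o (PrimeSpectrum (coordRing X))ᵒᵈ :=
    { toFun := fun Z => OrderDual.toDual
        ⟨vanishingIdealOn (Z : Set X), isIrreducible_iff_vanishingIdealOn_isPrime.mp Z.2⟩
      invFun := fun p =>
        ⟨{x : X | ∀ f ∈ (OrderDual.ofDual p).asIdeal, f.1 x = 0},
          isIrreducible_iff_vanishingIdealOn_isPrime.mpr (by
            rw [vanishingIdealOn_zeros hX]; exact (OrderDual.ofDual p).2),
          isClosed_zeros _⟩
      left_inv := fun Z => TopologicalSpace.IrreducibleCloseds.ext (zeros_vanishingIdealOn Z.3)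
      right_inv := fun p => PrimeSpectrum.ext (vanishingIdealOn_zeros hX _)
      map_rel_iff' := by
        intro Z W
        constructor
        · intro h x hx
          exact isClosed_iff_forall_coordRing.mp W.3 x fun f hf => h hf x hx
        · exact fun h f hf x hx => hf x (h hx) }
  rw [topologicalKrullDim, Order.krullDim_eq_of_orderIso e, Order.krullDim_orderDual, ringKrullDim]

theorem topologicalKrullDim_eq_trdeg [IsAlgClosed K] {X : Set (AffSpace K n)}
    (hX : IsClosed X) (hirr : IsIrreducible X) :
    topologicalKrullDim X =
      ((Cardinal.toENat (Algebra.trdeg K (coordRing X)) : ℕ∞) : WithBot ℕ∞) := by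
  have := coordRing_isDomain hirr
  rw [topologicalKrullDim_eq_ringKrullDim hX, ringKrullDim_eq_trdeg K]

theorem topologicalKrullDim_image_val {X : Set (AffSpace K n)} (D : Set X) :
    topologicalKrullDim (Subtype.val '' D : Set (AffSpace K n)) = topologicalKrullDim D :=
  (IsHomeomorph.topologicalKrullDim_eq _
    (Topology.IsEmbedding.subtypeVal.homeomorphImage D).isHomeomorph).symm

theorem restrict_mem_coordRing {X : Set (AffSpace K n)} (D : Set X) (f : coordRing X) :
    (fun y : (Subtype.val '' D : Set (AffSpace K n)) =>
      f.1 ⟨y.1, Subtype.coe_image_subset X D y.2⟩) ∈ coordRing (Subtype.val '' D) := by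
  obtain ⟨p, rfl⟩ := polyRestrict_surjective X f
  have h : (fun y : (Subtype.val '' D : Set (AffSpace K n)) =>
      (polyRestrict X p).1 ⟨y.1, Subtype.coe_image_subset X D y.2⟩) =
      (polyRestrict (Subtype.val '' D) p).1 :=
    funext fun y => (polyRestrict_apply X p _).trans (polyRestrict_apply _ p y).symm
  rw [h]
  exact (polyRestrict (Subtype.val '' D) p).2

/-- Restriction of regular functions on `X` to a subset of `X`. -/
noncomputable def restrictTo {X : Set (AffSpace K n)} (D : Set X) :
    coordRing X →ₐ[K] coordRing (Subtype.val '' D : Set (AffSpace K n)) where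
  toFun f := ⟨_, restrict_mem_coordRing D f⟩
  map_one' := rfl
  map_mul' _ _ := rfl
  map_zero' := rfl
  map_add' _ _ := rfl
  commutes' _ := rfl

theorem restrictTo_apply {X : Set (AffSpace K n)} (D : Set X) (f : coordRing X)
    (x : X) (hx : x ∈ D) : (restrictTo D f).1 ⟨x.1, x, hx, rfl⟩ = f.1 x := rfl

theorem restrictTo_eq_zero_iff {X : Set (AffSpace K n)} (D : Set X) (f : coordRing X) :
    restrictTo D f = 0 ↔ ∀ x ∈ D, f.1 x = 0 := by
  constructor
  · intro h x hx
    rw [← restrictTo_apply D f x hx, h]; rfl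
  · intro h
    apply coordRing_ext
    rintro ⟨_, x, hx, rfl⟩
    exact h x hx

theorem restrictTo_surjective {X : Set (AffSpace K n)} (D : Set X) :
    Function.Surjective (restrictTo D) := by
  intro g
  obtain ⟨p, rfl⟩ := polyRestrict_surjective _ g
  refine ⟨polyRestrict X p, coordRing_ext ?_⟩
  rintro ⟨_, x, hx, rfl⟩
  exact (polyRestrict_apply X p x).trans
    (polyRestrict_apply (Subtype.val '' D : Set (AffSpace K n)) p ⟨x.1, x, hx, rfl⟩).symm

theorem trdeg_coordRing_lt_aleph0 {X : Set (AffSpace K n)} :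
    Algebra.trdeg K (coordRing X) < Cardinal.aleph0 :=
  trdeg_lt_aleph0_of_finiteType

/-- Finiteness is needed because `toENat` identifies all infinite cardinals. -/
theorem toENat_add_one_eq_iff {a b : Cardinal} (ha : a < Cardinal.aleph0)
    (hb : b < Cardinal.aleph0) :
    ((Cardinal.toENat a : ℕ∞) : WithBot ℕ∞) + 1 = ((Cardinal.toENat b : ℕ∞) : WithBot ℕ∞) ↔
      a + 1 = b := by
  rw [← Cardinal.toENat_eq_iff_of_le_aleph0
    (Cardinal.add_lt_aleph0 ha Cardinal.one_lt_aleph0).le hb.le, map_add, map_one]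
  norm_cast

theorem isPrimeDivisor_iff_trdeg [IsAlgClosed K] {X : Set (AffSpace K n)} (hX : IsClosed X)
    (hirr : IsIrreducible X) {D : Set X} (hD : IsClosed D) (hDirr : IsIrreducible D) :
    IsPrimeDivisor D ↔
      Algebra.trdeg K (coordRing (Subtype.val '' D : Set (AffSpace K n))) + 1 =
        Algebra.trdeg K (coordRing X) := by
  have hD' : IsClosed (Subtype.val '' D : Set (AffSpace K n)) :=
    hX.isClosedEmbedding_subtypeVal.isClosedMap D hD
  have hDirr' : IsIrreducible (Subtype.val '' D : Set (AffSpace K n)) :=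
    hDirr.image _ continuous_subtype_val.continuousOn
  rw [IsPrimeDivisor, ← topologicalKrullDim_image_val, topologicalKrullDim_eq_trdeg hD' hDirr',
    topologicalKrullDim_eq_trdeg hX hirr]
  simp only [hD, hDirr, true_and]
  exact toENat_add_one_eq_iff trdeg_coordRing_lt_aleph0 trdeg_coordRing_lt_aleph0

end RegularFunctions

/-! ### The weight grading of `K[X]`. -/

section Grading

/-- In characteristic zero the powers of `2` can be compared in `ℚ`. Thus `t = 2` serves below as a
torus element of infinite order. -/
theorem two_zpow_injective {K : Type*} [Field K] [CharZero K] :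
    Function.Injective fun i : ℤ => (2 : K) ^ i := by
  intro i j h
  have h3 : (((2 : ℚ) ^ i : ℚ) : K) = ((2 : ℚ) ^ j : ℚ) := by
    push_cast; exact h
  exact zpow_right_injective₀ (by norm_num) (by norm_num) (Rat.cast_injective h3)

theorem DirectSum.isInternal_of_forall_sum {R M ι : Type*} [Ring R] [AddCommGroup M] [Module R M]
    [DecidableEq ι] {W : ι → Submodule R M}
    (h0 : ∀ (s : Finset ι) (c : ι → M), (∀ i ∈ s, c i ∈ W i) → ∑ i ∈ s, c i = 0 →
      ∀ i ∈ s, c i = 0)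
    (h1 : ∀ m, ∃ (s : Finset ι) (c : ι → M), (∀ i ∈ s, c i ∈ W i) ∧ ∑ i ∈ s, c i = m) :
    DirectSum.IsInternal W := by
  classical
  constructor
  · rw [injective_iff_map_eq_zero]
    intro v hv
    have hv' : ∑ i ∈ v.support, ((v i : W i) : M) = 0 :=
      (DirectSum.coeLinearMap_eq_dfinsuppSum W v).symm.trans hv
    refine DFinsupp.ext fun i => ?_
    by_cases hi : i ∈ v.support
    · exact Subtype.ext (h0 v.support _ (fun i _ => (v i).2) hv' i hi)
    · simpa using hi
  · intro m
    obtain ⟨s, c, hc, rfl⟩ := h1 m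
    refine ⟨∑ i ∈ s.attach, DirectSum.of (fun i => W i) i.1 ⟨c i.1, hc i.1 i.2⟩, ?_⟩
    rw [map_sum]
    simp only [DirectSum.coeAddMonoidHom_of]
    exact Finset.sum_attach s c

/-- Dedekind's independence of characters, applied to `t ↦ t ^ w i`; these are distinct because they
differ at `t = 2`. -/
theorem eq_zero_of_forall_sum_zpow_eq_zero {K : Type*} [Field K] [CharZero K] {ι : Type*}
    {w : ι → ℤ} (hw : Function.Injective w) (s : Finset ι) (a : ι → K)
    (h : ∀ t : Kˣ, ∑ i ∈ s, ((t ^ w i : Kˣ) : K) * a i = 0) : ∀ i ∈ s, a i = 0 := by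
  let χ : ι → (Kˣ →* K) := fun i => (Units.coeHom K).comp (zpowGroupHom (w i))
  have hχ : Function.Injective χ := by
    intro i j hij
    apply hw
    have h2 : (2 : K) ≠ 0 := two_ne_zero
    have h1 : ((2 : K)) ^ w i = (2 : K) ^ w j := by
      simpa [χ] using DFunLike.congr_fun hij (Units.mk0 (2 : K) h2)
    exact two_zpow_injective h1
  have hlin := (linearIndependent_monoidHom Kˣ K).comp χ hχ
  refine linearIndependent_iff'.mp hlin s a (funext fun t => ?_)
  rw [Finset.sum_apply]
  refine Eq.trans ?_ (h t)
  exact Finset.sum_congr rfl fun i _ => by simp [χ, mul_comm]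

variable {K : Type u} [Field K] {n : ℕ} {X : Set (AffSpace K n)}

theorem coordRing_coe_sum_apply {ι : Type*} (s : Finset ι) (c : ι → coordRing X) (x : X) :
    (∑ i ∈ s, c i).1 x = ∑ i ∈ s, (c i).1 x :=
  map_sum (evalAt x) c s

variable [MulAction Kˣ X]

theorem mem_invariantRing_iff_mem_weightSpace_zero {f : coordRing X} :
    f ∈ invariantRing X ↔ f ∈ weightSpace X 0 := by
  rw [← invariantRing_toSubmodule]; rfl

variable (X) in
instance weightSpace.gradedMonoid : SetLike.GradedMonoid (weightSpace X) where
  one_mem := fun t x => by simp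
  mul_mem := fun {i j f g} hf hg t x => by
    have h1 := hf t x
    have h2 := hg t x
    simp only [Subalgebra.coe_mul, Pi.mul_apply, h1, h2, zpow_add, Units.val_mul]
    ring

theorem sum_weight_apply_smul {ι : Type*} {w : ι → ℤ} (s : Finset ι) {c : ι → coordRing X}
    (hc : ∀ i ∈ s, c i ∈ weightSpace X (w i)) (t : Kˣ) (x : X) :
    (∑ i ∈ s, c i).1 (t • x) = ∑ i ∈ s, ((t ^ w i : Kˣ) : K) * (c i).1 x := by
  rw [coordRing_coe_sum_apply]
  exact Finset.sum_congr rfl fun i hi => hc i hi t x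

theorem weight_components_vanish [CharZero K] {ι : Type*} {w : ι → ℤ}
    (hw : Function.Injective w) (s : Finset ι) {c : ι → coordRing X}
    (hc : ∀ i ∈ s, c i ∈ weightSpace X (w i)) {x : X}
    (h : ∀ t : Kˣ, (∑ i ∈ s, c i).1 (t • x) = 0) : ∀ i ∈ s, (c i).1 x = 0 :=
  eq_zero_of_forall_sum_zpow_eq_zero hw s _ fun t => by
    rw [← sum_weight_apply_smul s hc, h]

theorem weight_independent [CharZero K] {ι : Type*} {w : ι → ℤ}
    (hw : Function.Injective w) (s : Finset ι) {c : ι → coordRing X}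
    (hc : ∀ i ∈ s, c i ∈ weightSpace X (w i)) (h : ∑ i ∈ s, c i = 0) : ∀ i ∈ s, c i = 0 :=
  fun i hi => coordRing_ext fun x => weight_components_vanish hw s hc (fun t => by rw [h]; rfl) i hi

theorem exists_sum_weights [CharZero K] (hreg : IsRegularAction X) (f : coordRing X) :
    ∃ (s : Finset ℤ) (c : ℤ → coordRing X), (∀ i ∈ s, c i ∈ weightSpace X i) ∧
      ∑ i ∈ s, c i = f := by
  obtain ⟨c, hc⟩ := hreg f.1 f.2
  refine ⟨c.support, c, fun i hi s x => ?_, coordRing_ext fun x => ?_⟩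
  -- Expanding `f (t • (s • x)) = f ((t * s) • x)` in powers of `t` and comparing coefficients shows
  -- that each `c i` has weight `i`.
  · have h := eq_zero_of_forall_sum_zpow_eq_zero (K := K) (w := id) Function.injective_id c.support
      (fun i => (c i).1 (s • x) - ((s ^ i : Kˣ) : K) * (c i).1 x) (fun t => by
        simp only [mul_sub, Finset.sum_sub_distrib, id, ← mul_assoc, ← Units.val_mul, ← mul_zpow]
        rw [sub_eq_zero]
        refine (hc t (s • x)).symm.trans ?_
        rw [smul_smul]
        exact hc (t * s) x)
    exact sub_eq_zero.mp (h i hi)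
  · rw [coordRing_coe_sum_apply]
    have := hc 1 x
    simp only [one_smul, one_zpow, Units.val_one, one_mul] at this
    exact this.symm

theorem isInternal_weightSpace [CharZero K] (hreg : IsRegularAction X) :
    DirectSum.IsInternal (weightSpace X) :=
  DirectSum.isInternal_of_forall_sum
    (fun s _ hc h => weight_independent Function.injective_id s hc h) (exists_sum_weights hreg)

/-- The grading of the algebra of regular functions given by a regular action of `𝔾ₘ`. -/
noncomputable abbrev weightGrading [CharZero K] (hreg : IsRegularAction X) :
    GradedAlgebra (weightSpace X) :=
  (isInternal_weightSpace hreg).gradedAlgebra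

theorem eq_of_forall_weightSpace [CharZero K] (hreg : IsRegularAction X) {x y : X}
    (h : ∀ i, ∀ f ∈ weightSpace X i, f.1 x = f.1 y) : x = y := by
  refine eq_of_forall_coordFun fun j => ?_
  obtain ⟨s, c, hc, hs⟩ := exists_sum_weights hreg (coordFun X j)
  rw [← hs, coordRing_coe_sum_apply, coordRing_coe_sum_apply]
  exact Finset.sum_congr rfl fun i hi => h i _ (hc i hi)

theorem weight_apply_eq_zero_of_fixed [CharZero K] {i : ℤ} (hi : i ≠ 0) {f : coordRing X}
    (hf : f ∈ weightSpace X i) {x : X} (hx : ∀ t : Kˣ, t • x = x) : f.1 x = 0 := by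
  have h2 : (2 : K) ≠ 0 := two_ne_zero
  have h1 := hf (Units.mk0 2 h2) x
  rw [hx] at h1
  by_contra hne
  have h3 : ((2 : K)) ^ i = 2 ^ (0 : ℤ) := by
    have := mul_right_cancel₀ hne ((one_mul _).trans h1)
    simpa using this.symm
  exact hi (two_zpow_injective h3)

theorem mem_fixedPoints_iff_forall_weightSpace [CharZero K] (hreg : IsRegularAction X) {x : X} :
    x ∈ MulAction.fixedPoints Kˣ X ↔ ∀ i ≠ 0, ∀ f ∈ weightSpace X i, f.1 x = 0 := by
  constructor
  · exact fun hx i hi f hf => weight_apply_eq_zero_of_fixed hi hf hx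
  · intro h t
    refine eq_of_forall_weightSpace hreg fun i f hf => ?_
    rw [hf t x]
    by_cases hi : i = 0
    · simp [hi]
    · simp [h i hi f hf]

/-- Otherwise every point would be fixed, and `t = 2` would act as the identity. -/
theorem exists_weight_ne_zero [CharZero K] (hreg : IsRegularAction X) (heff : FaithfulSMul Kˣ X) :
    ∃ i : ℤ, i ≠ 0 ∧ ∃ f ∈ weightSpace X i, f ≠ 0 := by
  by_contra! h
  have h2 : (2 : K) ≠ 0 := two_ne_zero
  have h1 : Units.mk0 (2 : K) h2 = 1 := heff.eq_of_smul_eq_smul fun x => by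
    rw [one_smul]
    exact (mem_fixedPoints_iff_forall_weightSpace hreg).mpr
      (fun i hi f hf => by rw [h i hi f hf]; rfl) _
  have := congrArg Units.val h1
  norm_num at this

/-- The terms of a polynomial relation over the invariants have distinct weights, so each vanishes.
-/
theorem transcendental_of_weight [CharZero K] [IsDomain (coordRing X)] {k : ℤ} (hk : k ≠ 0)
    {f : coordRing X} (hf : f ∈ weightSpace X k) (hf0 : f ≠ 0) :
    Transcendental (invariantRing X) f := by
  rw [transcendental_iff]
  intro p hp
  rw [Polynomial.aeval_eq_sum_range] at hp
  have hw : Function.Injective fun j : ℕ => (j : ℤ) * k := fun a b hab => by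
    simpa [hk] using hab
  have h := weight_independent hw _ (fun j _ => ?_) hp
  · ext j : 1
    by_cases hj : j ∈ Finset.range (p.natDegree + 1)
    · have h1 := h j hj
      rw [Algebra.smul_def, mul_eq_zero] at h1
      have h2 := h1.resolve_right (pow_ne_zero j hf0)
      simpa using Subtype.ext h2
    · rw [Finset.mem_range, not_lt] at hj
      rw [Polynomial.coeff_eq_zero_of_natDegree_lt (by omega)]
      simp
  · have h1 := SetLike.mul_mem_graded (A := weightSpace X)
      (mem_invariantRing_iff_mem_weightSpace_zero.mp (p.coeff j).2) (SetLike.pow_mem_graded j hf)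
    simpa [Algebra.smul_def, nsmul_eq_mul] using h1

theorem trdeg_invariantRing_add [IsDomain (coordRing X)] :
    Algebra.trdeg K (invariantRing X) + Algebra.trdeg (invariantRing X) (coordRing X) =
      Algebra.trdeg K (coordRing X) :=
  trdeg_add_eq K (invariantRing X)

theorem trdeg_invariantRing_lt_aleph0 :
    Algebra.trdeg K (invariantRing X) < Cardinal.aleph0 :=
  (trdeg_le_of_injective (invariantRing X).val Subtype.val_injective).trans_lt
    trdeg_coordRing_lt_aleph0

theorem trdeg_invariantRing_add_one_le [CharZero K] [IsDomain (coordRing X)] {k : ℤ} (hk : k ≠ 0)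
    {f : coordRing X} (hf : f ∈ weightSpace X k) (hf0 : f ≠ 0) :
    Algebra.trdeg K (invariantRing X) + 1 ≤ Algebra.trdeg K (coordRing X) := by
  rw [← trdeg_invariantRing_add]
  gcongr
  have : Algebra.Transcendental (invariantRing X) (coordRing X) :=
    ⟨f, transcendental_of_weight hk hf hf0⟩
  exact Cardinal.one_le_iff_pos.mpr (trdeg_pos _ _)

end Grading

/-! ### The weight-zero projection and limit points. -/

section DegreeZero

variable {K : Type u} [Field K] [CharZero K] {n : ℕ} {X : Set (AffSpace K n)} [MulAction Kˣ X]

/-- The projection of a regular function to its component of weight zero. -/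
noncomputable def degreeZero (hreg : IsRegularAction X) : coordRing X →ₗ[K] coordRing X :=
  letI := weightGrading hreg
  GradedAlgebra.proj (weightSpace X) 0

theorem degreeZero_mem (hreg : IsRegularAction X) (f : coordRing X) :
    degreeZero hreg f ∈ invariantRing X :=
  letI := weightGrading hreg
  mem_invariantRing_iff_mem_weightSpace_zero.mpr (DirectSum.decompose (weightSpace X) f 0).2

theorem degreeZero_of_mem (hreg : IsRegularAction X) {f : coordRing X}
    (hf : f ∈ invariantRing X) : degreeZero hreg f = f :=
  letI := weightGrading hreg
  DirectSum.decompose_of_mem_same (weightSpace X) (mem_invariantRing_iff_mem_weightSpace_zero.mp hf)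

theorem degreeZero_of_mem_ne (hreg : IsRegularAction X) {i : ℤ} (hi : i ≠ 0) {f : coordRing X}
    (hf : f ∈ weightSpace X i) : degreeZero hreg f = 0 :=
  letI := weightGrading hreg
  DirectSum.decompose_of_mem_ne (weightSpace X) hf hi

theorem degreeZero_apply_of_fixed (hreg : IsRegularAction X) (f : coordRing X) {x : X}
    (hx : x ∈ MulAction.fixedPoints Kˣ X) : (degreeZero hreg f).1 x = f.1 x := by
  obtain ⟨s, c, hc, rfl⟩ := exists_sum_weights hreg f
  rw [map_sum, coordRing_coe_sum_apply, coordRing_coe_sum_apply]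
  refine Finset.sum_congr rfl fun i hi => ?_
  by_cases h0 : i = 0
  · subst h0
    rw [degreeZero_of_mem hreg (mem_invariantRing_iff_mem_weightSpace_zero.mpr (hc 0 hi))]
  · rw [degreeZero_of_mem_ne hreg h0 (hc i hi), weight_apply_eq_zero_of_fixed h0 (hc i hi) hx]
    rfl

theorem degreeZero_apply_eq_zero (hreg : IsRegularAction X) (f : coordRing X) {x : X}
    (hf : ∀ y ∈ MulAction.orbit Kˣ x, f.1 y = 0) : (degreeZero hreg f).1 x = 0 := by
  obtain ⟨s, c, hc, rfl⟩ := exists_sum_weights hreg f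
  rw [map_sum, coordRing_coe_sum_apply]
  refine Finset.sum_eq_zero fun i hi => ?_
  by_cases h0 : i = 0
  · subst h0
    rw [degreeZero_of_mem hreg (mem_invariantRing_iff_mem_weightSpace_zero.mpr (hc 0 hi))]
    exact weight_components_vanish Function.injective_id s hc
      (fun t => hf _ (MulAction.mem_orbit x t)) 0 hi
  · rw [degreeZero_of_mem_ne hreg h0 (hc i hi)]
    rfl

variable (X) in
/-- Regular functions of opposite non-zero weights have zero product. On an irreducible variety
this says that all weights have the same sign. -/
def IsSemidefinite : Prop :=
  ∀ i : ℤ, i ≠ 0 → ∀ f ∈ weightSpace X i, ∀ g ∈ weightSpace X (-i), f * g = 0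

theorem degreeZero_mul (hreg : IsRegularAction X) (hs : IsSemidefinite X) (f g : coordRing X) :
    degreeZero hreg (f * g) = degreeZero hreg f * degreeZero hreg g := by
  obtain ⟨s, c, hc, rfl⟩ := exists_sum_weights hreg f
  obtain ⟨r, d, hd, rfl⟩ := exists_sum_weights hreg g
  simp only [map_sum, Finset.sum_mul_sum]
  refine Finset.sum_congr rfl fun i hi => Finset.sum_congr rfl fun j hj => ?_
  have hij := SetLike.mul_mem_graded (A := weightSpace X) (hc i hi) (hd j hj)
  by_cases hi0 : i = 0
  · subst hi0
    have h1 := mem_invariantRing_iff_mem_weightSpace_zero.mpr (hc 0 hi)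
    rw [degreeZero_of_mem hreg h1]
    by_cases hj0 : j = 0
    · subst hj0
      have h2 := mem_invariantRing_iff_mem_weightSpace_zero.mpr (hd 0 hj)
      rw [degreeZero_of_mem hreg h2, degreeZero_of_mem hreg (mul_mem h1 h2)]
    · rw [degreeZero_of_mem_ne hreg hj0 (hd j hj), mul_zero,
        degreeZero_of_mem_ne hreg (by rwa [zero_add]) hij]
  · rw [degreeZero_of_mem_ne hreg hi0 (hc i hi), zero_mul]
    -- Only cross terms of opposite weights could contribute in weight zero, and semidefiniteness
    -- kills them.
    by_cases hij0 : i + j = 0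
    · obtain rfl : j = -i := by omega
      rw [hs i hi0 _ (hc i hi) _ (hd _ hj), map_zero]
    · exact degreeZero_of_mem_ne hreg hij0 hij

/-- For a semidefinite grading the projection to weight zero is a retraction of algebras. -/
noncomputable def invariantProj (hreg : IsRegularAction X) (hs : IsSemidefinite X) :
    coordRing X →ₐ[K] invariantRing X :=
  AlgHom.ofLinearMap ((degreeZero hreg).codRestrict (Subalgebra.toSubmodule (invariantRing X))
    (degreeZero_mem hreg))
    (Subtype.ext (degreeZero_of_mem hreg (one_mem _)))
    (fun f g => Subtype.ext (degreeZero_mul hreg hs f g))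

@[simp]
theorem coe_invariantProj (hreg : IsRegularAction X) (hs : IsSemidefinite X) (f : coordRing X) :
    (invariantProj hreg hs f : coordRing X) = degreeZero hreg f := rfl

theorem invariantProj_surjective (hreg : IsRegularAction X) (hs : IsSemidefinite X) :
    Function.Surjective (invariantProj hreg hs) :=
  fun f => ⟨f.1, Subtype.ext (degreeZero_of_mem hreg f.2)⟩

/-- The character "project to weight zero, then evaluate at `x`" is evaluation at a point `y`, in
effect the limit of `t • x` as `t` tends to `0` or `∞`. It kills all nonzero weights, so `y` is
fixed. -/
theorem exists_limit_point (hX : IsClosed X) (hreg : IsRegularAction X) (hs : IsSemidefinite X)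
    (x : X) : ∃ y ∈ MulAction.fixedPoints Kˣ X,
      ∀ f : coordRing X, f.1 y = (degreeZero hreg f).1 x := by
  obtain ⟨y, hy⟩ := exists_evalAt_eq hX
    ((evalAt x).comp ((invariantRing X).val.comp (invariantProj hreg hs)))
  have hy' : ∀ f : coordRing X, f.1 y = (degreeZero hreg f).1 x := fun f => (hy f).symm
  refine ⟨y, ?_, hy'⟩
  rw [mem_fixedPoints_iff_forall_weightSpace hreg]
  intro i hi f hf
  rw [hy', degreeZero_of_mem_ne hreg hi hf]
  rfl

theorem mem_closure_orbit_of_degreeZero (hreg : IsRegularAction X) {x y : X}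
    (hy : ∀ f : coordRing X, f.1 y = (degreeZero hreg f).1 x) :
    y ∈ closure (MulAction.orbit Kˣ x) :=
  mem_closure_iff_forall_coordRing.mpr fun f hf => by
    rw [hy, degreeZero_apply_eq_zero hreg f hf]

theorem isClosed_mulAction_fixedPoints (hreg : IsRegularAction X) :
    IsClosed (MulAction.fixedPoints Kˣ X) := by
  convert! isClosed_zeros {f : coordRing X | ∃ i ≠ 0, f ∈ weightSpace X i} using 1
  ext x
  rw [mem_fixedPoints_iff_forall_weightSpace hreg]
  exact ⟨fun h f ⟨i, hi, hf⟩ => h i hi f hf, fun h i hi f hf => h f ⟨i, hi, hf⟩⟩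

/-- At fixed points a function agrees with its weight-zero part, and limit points realise every
value of that part. -/
theorem vanishingIdealOn_fixedPoints (hX : IsClosed X) (hreg : IsRegularAction X)
    (hs : IsSemidefinite X) :
    vanishingIdealOn (MulAction.fixedPoints Kˣ X) = RingHom.ker (invariantProj hreg hs) := by
  ext f
  rw [RingHom.mem_ker, mem_vanishingIdealOn, ← Subtype.val_inj (b := (0 : invariantRing X)),
    coe_invariantProj]
  constructor
  · intro h
    refine coordRing_ext fun x => ?_
    obtain ⟨y, hy, hyx⟩ := exists_limit_point hX hreg hs x
    rw [← hyx, h y hy]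
    rfl
  · intro h x hx
    rw [← degreeZero_apply_of_fixed hreg f hx, h]
    rfl

theorem restrictTo_invariantRing_surjective (hreg : IsRegularAction X) {D : Set X}
    (hfix : IsPointwiseFixed D) :
    Function.Surjective ((restrictTo D).comp (invariantRing X).val) := by
  intro g
  obtain ⟨f, rfl⟩ := restrictTo_surjective D g
  refine ⟨⟨_, degreeZero_mem hreg f⟩, ?_⟩
  rw [← sub_eq_zero]
  change restrictTo D (degreeZero hreg f) - _ = 0
  rw [← map_sub, restrictTo_eq_zero_iff]
  intro x hx
  exact sub_eq_zero.mpr (degreeZero_apply_of_fixed hreg f (hfix x hx))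

end DegreeZero

/-! ### Pointwise fixed prime divisors. -/

section Divisors

variable {K : Type u} [Field K] [IsAlgClosed K] [CharZero K] {n : ℕ} {X : Set (AffSpace K n)}
  [MulAction Kˣ X]

theorem exists_fixed_primeDivisor (hX : IsClosed X) (hirr : IsIrreducible X)
    (hreg : IsRegularAction X) (hs : IsSemidefinite X)
    (htr : Algebra.trdeg K (invariantRing X) + 1 = Algebra.trdeg K (coordRing X)) :
    ∃ D : Set X, IsPrimeDivisor D ∧ IsPointwiseFixed D := by
  have := coordRing_isDomain hirr
  set F := MulAction.fixedPoints Kˣ X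
  have hfix : IsPointwiseFixed F := fun x hx => hx
  refine ⟨F, ?_, hfix⟩
  have hI := vanishingIdealOn_fixedPoints hX hreg hs
  have hFirr : IsIrreducible F := by
    rw [isIrreducible_iff_vanishingIdealOn_isPrime, hI]
    exact RingHom.ker_isPrime _
  rw [isPrimeDivisor_iff_trdeg hX hirr (isClosed_mulAction_fixedPoints hreg) hFirr, ← htr]
  congr 1
  symm
  refine (AlgEquiv.ofBijective ((restrictTo F).comp (invariantRing X).val)
    ⟨?_, restrictTo_invariantRing_surjective hreg hfix⟩).trdeg_eq
  rw [injective_iff_map_eq_zero]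
  intro f hf
  have h1 : f.1 ∈ vanishingIdealOn F := (restrictTo_eq_zero_iff F f.1).mp hf
  rw [hI, RingHom.mem_ker] at h1
  exact Subtype.ext ((degreeZero_of_mem hreg f.2).symm.trans (congrArg Subtype.val h1))

/-- The map is onto and `trdeg A₀ ≤ trdeg A - 1 = trdeg K[D]`, so `AlgHom.injective_of_trdeg_le`
applies. -/
theorem restrictTo_invariantRing_injective (hX : IsClosed X) (hirr : IsIrreducible X)
    (hreg : IsRegularAction X) (heff : FaithfulSMul Kˣ X) {D : Set X} (hD : IsPrimeDivisor D)
    (hfix : IsPointwiseFixed D) :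
    Function.Injective ((restrictTo D).comp (invariantRing X).val) := by
  have := coordRing_isDomain hirr
  have htr := (isPrimeDivisor_iff_trdeg hX hirr hD.1 hD.2.1).mp hD
  have hdom : IsDomain (coordRing (Subtype.val '' D : Set (AffSpace K n))) :=
    coordRing_isDomain (hD.2.1.image _ continuous_subtype_val.continuousOn)
  obtain ⟨k, hk, f, hf, hf0⟩ := exists_weight_ne_zero hreg heff
  have hle := trdeg_invariantRing_add_one_le hk hf hf0
  rw [← htr] at hle
  have hle' := Cardinal.add_one_le_add_one_iff.mp hle
  have h3 := restrictTo_invariantRing_surjective hreg hfix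
  have h4 := trdeg_invariantRing_lt_aleph0 (X := X)
  exact AlgHom.injective_of_trdeg_le (K := K) (R := invariantRing X)
    (S := coordRing (Subtype.val '' D : Set (AffSpace K n))) _ h3 h4 hle'

theorem trdeg_invariantRing_of_fixed_primeDivisor (hX : IsClosed X) (hirr : IsIrreducible X)
    (hreg : IsRegularAction X) (heff : FaithfulSMul Kˣ X) {D : Set X} (hD : IsPrimeDivisor D)
    (hfix : IsPointwiseFixed D) :
    Algebra.trdeg K (invariantRing X) + 1 = Algebra.trdeg K (coordRing X) := by
  rw [← (isPrimeDivisor_iff_trdeg hX hirr hD.1 hD.2.1).mp hD]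
  congr 1
  exact (AlgEquiv.ofBijective ((restrictTo D).comp (invariantRing X).val)
    ⟨restrictTo_invariantRing_injective hX hirr hreg heff hD hfix,
      restrictTo_invariantRing_surjective hreg hfix⟩).trdeg_eq

theorem invariant_eq_zero_of_vanish (hX : IsClosed X) (hirr : IsIrreducible X)
    (hreg : IsRegularAction X) (heff : FaithfulSMul Kˣ X) {D : Set X} (hD : IsPrimeDivisor D)
    (hfix : IsPointwiseFixed D) {f : coordRing X} (hf : f ∈ invariantRing X)
    (h : ∀ x ∈ D, f.1 x = 0) : f = 0 := by
  have hφ := restrictTo_invariantRing_injective hX hirr hreg heff hD hfix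
  rw [injective_iff_map_eq_zero] at hφ
  exact congrArg Subtype.val (hφ ⟨f, hf⟩ ((restrictTo_eq_zero_iff D f).mpr h))

theorem isSemidefinite_of_fixed_primeDivisor (hX : IsClosed X) (hirr : IsIrreducible X)
    (hreg : IsRegularAction X) (heff : FaithfulSMul Kˣ X) {D : Set X} (hD : IsPrimeDivisor D)
    (hfix : IsPointwiseFixed D) : IsSemidefinite X := by
  intro i hi f hf g hg
  refine invariant_eq_zero_of_vanish hX hirr hreg heff hD hfix
    (mem_invariantRing_iff_mem_weightSpace_zero.mpr ?_) fun x hx => ?_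
  · simpa using SetLike.mul_mem_graded (A := weightSpace X) hf hg
  · have h1 : f.1 x = 0 := weight_apply_eq_zero_of_fixed hi hf (hfix x hx)
    exact mul_eq_zero_of_left h1 _

theorem eq_fixedPoints_of_fixed_primeDivisor (hX : IsClosed X) (hirr : IsIrreducible X)
    (hreg : IsRegularAction X) (heff : FaithfulSMul Kˣ X) {D : Set X} (hD : IsPrimeDivisor D)
    (hfix : IsPointwiseFixed D) : D = MulAction.fixedPoints Kˣ X := by
  refine Set.Subset.antisymm (fun x hx => hfix x hx) fun x hx => ?_
  refine isClosed_iff_forall_coordRing.mp hD.1 x fun f hf => ?_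
  have h1 : degreeZero hreg f = 0 := invariant_eq_zero_of_vanish hX hirr hreg heff hD hfix
    (degreeZero_mem hreg f) fun y hy => by
      rw [degreeZero_apply_of_fixed hreg f (hfix y hy), hf y hy]
  rw [← degreeZero_apply_of_fixed hreg f hx, h1]
  rfl

end Divisors

/-! ### Points with prescribed values, via Chevalley's theorem. -/

theorem exists_infinite_values {K C A : Type u} [Field K] [IsAlgClosed K] [CommRing C] [IsDomain C]
    [IsNoetherianRing C] [CommRing A] [IsDomain A] [Algebra K C] [Algebra K A] [Algebra C A]
    [IsScalarTower K C A] [Algebra.FiniteType K A] {h v : A} (hh : Transcendental C h)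
    (hv : v ≠ 0) (hC : ∀ c : C, c ≠ 0 → ∃ ψ : C →ₐ[K] K, ψ c ≠ 0) :
    ∃ ψ : C →ₐ[K] K, {c : K | ∃ χ : A →ₐ[K] K,
      (∀ a : C, χ (algebraMap C A a) = ψ a) ∧ χ h = c ∧ χ v ≠ 0}.Infinite := by
  let φ : Polynomial C →ₐ[K] A := (Polynomial.aeval (R := C) h).restrictScalars K
  have hφ : Function.Injective φ := transcendental_iff_injective.mp hh
  -- Points of `C[T]` where `u` is nonzero lift to `A`. Once `ψ` keeps one coefficient of `u`
  -- nonzero, only the roots of the specialized polynomial `q` need be avoided as values of `h`.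
  obtain ⟨u, hu, H⟩ := exists_forall_extend_algHom φ hφ hv
  obtain ⟨j, hj⟩ : ∃ j, u.coeff j ≠ 0 := by
    by_contra! h0
    exact hu (Polynomial.ext (by simpa using h0))
  obtain ⟨ψ, hψ⟩ := hC _ hj
  refine ⟨ψ, ?_⟩
  let q : Polynomial K := u.map (ψ : C →+* K)
  have hq : q ≠ 0 := fun h0 => hψ (by simpa [q] using congrArg (Polynomial.coeff · j) h0)
  refine Set.Infinite.mono ?_ (Polynomial.finite_setOfPred_isRoot hq).infinite_compl
  intro c hc
  have hc' : q.eval c ≠ 0 := hc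
  let Ψ : Polynomial C →ₐ[K] K := (Polynomial.aeval c).comp (Polynomial.mapAlgHom ψ)
  have hΨu : Ψ u ≠ 0 := by
    have : Ψ u = q.eval c := by simp [Ψ, q, Polynomial.coe_aeval_eq_eval]
    rwa [this]
  obtain ⟨χ, hχ, hχv⟩ := H Ψ hΨu
  refine ⟨χ, fun a => ?_, ?_, hχv⟩
  · have := DFunLike.congr_fun hχ (Polynomial.C a)
    simpa [φ, Ψ] using this
  · have := DFunLike.congr_fun hχ Polynomial.X
    simpa [φ, Ψ] using this

theorem trdeg_le_one_or_exists_infinite_values {K A : Type u} [Field K] [IsAlgClosed K]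
    [CommRing A] [IsDomain A] [Algebra K A] [Algebra.FiniteType K A] (B : Type u) [CommRing B]
    [IsNoetherianRing B] [Algebra K B] [Algebra B A] [IsScalarTower K B A] {f v : A} (hv : v ≠ 0)
    (hA : ∀ a : A, a ≠ 0 → ∃ χ : A →ₐ[K] K, χ a ≠ 0) :
    Algebra.trdeg B A ≤ 1 ∨ ∃ (h : A) (ψ : A → K), {c : K | ∃ χ : A →ₐ[K] K,
      (∀ b : B, χ (algebraMap B A b) = ψ (algebraMap B A b)) ∧
        χ f = ψ f ∧ χ h = c ∧ χ v ≠ 0}.Infinite := by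
  classical
  let C := Algebra.adjoin B {f}
  by_cases halg : Algebra.IsAlgebraic C A
  · left
    simpa using Algebra.IsAlgebraic.trdeg_le_cardinalMk B ({f} : Set A)
  · right
    obtain ⟨h, hh⟩ : ∃ h : A, Transcendental C h := by
      by_contra! h0
      exact halg ⟨fun a => not_not.mp (h0 a)⟩
    have hCft : Algebra.FiniteType B C :=
      (Subalgebra.fg_iff_finiteType _).mp ⟨{f}, by simp [C]⟩
    have hCn : IsNoetherianRing C := Algebra.FiniteType.isNoetherianRing B C
    obtain ⟨ψ, hψ⟩ := exists_infinite_values (K := K) (C := C) hh hv (by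
      intro c hc
      obtain ⟨χ, hχ⟩ := hA c.1 (fun h0 => hc (Subtype.ext h0))
      exact ⟨χ.comp (IsScalarTower.toAlgHom K C A), hχ⟩)
    -- The value `0` off `C` is never used: only elements of `B` and `f` are tested.
    refine ⟨h, fun a => if ha : a ∈ C then ψ ⟨a, ha⟩ else 0, hψ.mono ?_⟩
    rintro c ⟨χ, h1, h2, h3⟩
    have hCχ : ∀ a (ha : a ∈ C), χ a = if ha : a ∈ C then ψ ⟨a, ha⟩ else 0 := by
      intro a ha
      rw [dif_pos ha]
      exact h1 ⟨a, ha⟩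
    exact ⟨χ, fun b => hCχ _ (Subalgebra.algebraMap_mem C b),
      hCχ f (Algebra.subset_adjoin rfl), h2, h3⟩

/-! ### Consequences of parabolicity. -/

section Parabolic

variable {K : Type u} [Field K] {n : ℕ} {X : Set (AffSpace K n)} [MulAction Kˣ X]

theorem invariant_apply_eq_of_mem_closure {f : coordRing X} (hf : f ∈ invariantRing X) {x y : X}
    (hy : y ∈ closure (MulAction.orbit Kˣ x)) : f.1 y = f.1 x := by
  have h := mem_closure_iff_forall_coordRing.mp hy (f - algebraMap K _ (f.1 x)) (by
    rintro _ ⟨t, rfl⟩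
    exact sub_eq_zero.mpr (hf t x))
  exact sub_eq_zero.mp h

theorem IsAlgClosed.exists_units_zpow_eq [IsAlgClosed K] {g : ℤ} (hg : g ≠ 0) (c : Kˣ) :
    ∃ t : Kˣ, t ^ g = c := by
  have key : ∀ m : ℕ, m ≠ 0 → ∀ c : Kˣ, ∃ t : Kˣ, t ^ m = c := by
    intro m hm c
    obtain ⟨z, hz⟩ := IsAlgClosed.exists_pow_nat_eq (c : K) (Nat.pos_of_ne_zero hm)
    have hz0 : z ≠ 0 := by
      rintro rfl
      rw [zero_pow hm] at hz
      exact c.ne_zero hz.symm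
    exact ⟨Units.mk0 z hz0, Units.ext (by simpa using hz)⟩
  obtain ⟨m, rfl | rfl⟩ := g.eq_nat_or_neg
  · obtain ⟨t, ht⟩ := key m (by simpa using hg) c
    exact ⟨t, by simpa using ht⟩
  · obtain ⟨t, ht⟩ := key m (by simpa using hg) c⁻¹
    exact ⟨t, by simp [ht]⟩

theorem weight_mul_pow_mem_invariantRing {k l : ℤ} {m : ℕ} {f g : coordRing X}
    (hf : f ∈ weightSpace X k) (hg : g ∈ weightSpace X l) (h : k + m * l = 0) :
    f * g ^ m ∈ invariantRing X := by
  rw [mem_invariantRing_iff_mem_weightSpace_zero, ← h]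
  simpa using SetLike.mul_mem_graded (A := weightSpace X) hf (SetLike.pow_mem_graded m hg)

variable (X) in
/-- The weights of the regular functions that do not vanish at a given point. -/
def weightsAt (x : X) : AddSubmonoid ℤ where
  carrier := {k | ∃ h ∈ weightSpace X k, h.1 x ≠ 0}
  zero_mem' := ⟨1, SetLike.one_mem_graded (weightSpace X), one_ne_zero⟩
  add_mem' := by
    rintro k l ⟨f, hf, hfx⟩ ⟨g, hg, hgx⟩
    exact ⟨f * g, SetLike.mul_mem_graded (A := weightSpace X) hf hg, mul_ne_zero hfx hgx⟩

/-- `-k = (|i| - 1) k - k |i|`, and every integer multiple of `i` lies in `S`. -/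
theorem neg_mem_of_mem_of_neg_mem {S : AddSubmonoid ℤ} {i : ℤ} (hi0 : i ≠ 0) (hi : i ∈ S)
    (hi' : -i ∈ S) {k : ℤ} (hk : k ∈ S) : -k ∈ S := by
  have hmul : ∀ m : ℤ, m * i ∈ S := by
    intro m
    obtain ⟨m, rfl | rfl⟩ := m.eq_nat_or_neg
    · simpa using S.nsmul_mem hi m
    · simpa using S.nsmul_mem hi' m
  have h1 : -k * i.natAbs ∈ S := by
    rcases Int.natAbs_eq i with h | h
    · rw [← h]; exact hmul _
    · have : (i.natAbs : ℤ) = -i := by omega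
      rw [this, neg_mul_neg]
      exact hmul k
  have h2 := S.add_mem (S.nsmul_mem hk (i.natAbs - 1)) h1
  have h3 : 1 ≤ i.natAbs := Int.natAbs_pos.mpr hi0
  have h4 : (i.natAbs - 1) • k + -k * i.natAbs = -k := by
    rw [nsmul_eq_mul]
    push_cast [h3]
    ring
  rwa [h4] at h2

/-- The weights of functions nonzero at `x` form a group `γℤ`, so there are `e`, `e'` of weights
`γ`, `-γ` nonzero at `x`. The product `e e'` is invariant, so both stay nonzero at a point `y` of
the closure, and `t ^ γ = e(y) / e(x)` determines a `t` with `t • x = y`. -/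
theorem isClosed_orbit_of_opposite_weights [IsAlgClosed K] [CharZero K]
    (hreg : IsRegularAction X) {i : ℤ} (hi : i ≠ 0) {x : X} {f g : coordRing X}
    (hf : f ∈ weightSpace X i) (hg : g ∈ weightSpace X (-i)) (hfx : f.1 x ≠ 0)
    (hgx : g.1 x ≠ 0) : IsClosed (MulAction.orbit Kˣ x) := by
  let S : AddSubgroup ℤ :=
    { weightsAt X x with
      neg_mem' := fun hk =>
        neg_mem_of_mem_of_neg_mem (S := weightsAt X x) hi ⟨f, hf, hfx⟩ ⟨g, hg, hgx⟩ hk }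
  obtain ⟨γ, hγ⟩ := Int.subgroup_cyclic S
  have hγS : ∀ k, k ∈ S → ∃ m : ℤ, k = m * γ := by
    intro k hk
    rw [hγ, AddSubgroup.mem_closure_singleton] at hk
    obtain ⟨m, hm⟩ := hk
    exact ⟨m, by simpa using hm.symm⟩
  have hγmem : γ ∈ S := by rw [hγ]; exact AddSubgroup.subset_closure rfl
  have hγ0 : γ ≠ 0 := by
    rintro rfl
    obtain ⟨m, hm⟩ := hγS i ⟨f, hf, hfx⟩
    exact hi (by simpa using hm)
  obtain ⟨e', he', hex'⟩ := S.neg_mem hγmem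
  obtain ⟨e, he, hex⟩ := hγmem
  refine closure_subset_iff_isClosed.mp fun y hy => ?_
  have hprod : e.1 y * e'.1 y = e.1 x * e'.1 x := by
    have h1 : e * e' ∈ invariantRing X := by
      simpa using weight_mul_pow_mem_invariantRing (m := 1) he he' (by simp)
    exact invariant_apply_eq_of_mem_closure h1 hy
  have hey : e.1 y ≠ 0 := left_ne_zero_of_mul (hprod.trans_ne (mul_ne_zero hex hex'))
  have hey' : e'.1 y ≠ 0 := right_ne_zero_of_mul (hprod.trans_ne (mul_ne_zero hex hex'))
  obtain ⟨t, ht⟩ := IsAlgClosed.exists_units_zpow_eq hγ0 (Units.mk0 _ hey / Units.mk0 _ hex)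
  have ht' : ((t ^ γ : Kˣ) : K) = e.1 y / e.1 x := by rw [ht]; simp
  refine ⟨t, (eq_of_forall_weightSpace hreg fun k h hh => ?_).symm⟩
  simp only [hh t x]
  -- A weight function zero at `x` vanishes on the orbit closure; any other becomes invariant after
  -- multiplication by a power of `e` or `e'`.
  by_cases hhx : h.1 x = 0
  · rw [hhx, mul_zero]
    refine mem_closure_iff_forall_coordRing.mp hy h ?_
    rintro _ ⟨s, rfl⟩
    simp only [hh s x, hhx, mul_zero]
  · obtain ⟨m, rfl⟩ := hγS k ⟨h, hh, hhx⟩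
    rw [mul_comm m γ, zpow_mul, Units.val_zpow_eq_zpow_val, ht']
    obtain ⟨m, rfl | rfl⟩ := m.eq_nat_or_neg
    · have h1 := invariant_apply_eq_of_mem_closure
        (weight_mul_pow_mem_invariantRing (m := m) hh he' (by ring)) hy
      have h2 : h.1 y * e'.1 y ^ m = h.1 x * e'.1 x ^ m := h1
      have h3 : e.1 y / e.1 x = e'.1 x / e'.1 y := by
        rw [div_eq_div_iff hex hey', hprod]; ring
      rw [h3, zpow_natCast, div_pow, div_mul_eq_mul_div, eq_div_iff (pow_ne_zero _ hey'), h2,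
        mul_comm]
    · have h1 := invariant_apply_eq_of_mem_closure
        (weight_mul_pow_mem_invariantRing (m := m) hh he (by ring)) hy
      have h2 : h.1 y * e.1 y ^ m = h.1 x * e.1 x ^ m := h1
      rw [zpow_neg, zpow_natCast, div_pow, inv_div, div_mul_eq_mul_div,
        eq_div_iff (pow_ne_zero _ hey), h2, mul_comm]

theorem IsParabolic.isSemidefinite [IsAlgClosed K] [CharZero K] (hirr : IsIrreducible X)
    (hreg : IsRegularAction X) (hpar : IsParabolic X) : IsSemidefinite X := by
  have := coordRing_isDomain hirr
  obtain ⟨U, hU, ⟨u, hu⟩, hUc, -⟩ := hpar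
  obtain ⟨v, hvu, hv⟩ := exists_basicOpen_subset hU hu
  intro i hi f hf g hg
  by_contra hne
  have hv0 : v ≠ 0 := fun h => hvu (by rw [h]; rfl)
  obtain ⟨x, hx⟩ := coordRing_exists_ne (mul_ne_zero hv0 hne)
  have hx' : v.1 x * (f.1 x * g.1 x) ≠ 0 := hx
  exact hUc x (hv x (left_ne_zero_of_mul hx')) (isClosed_orbit_of_opposite_weights hreg hi hf hg
    (left_ne_zero_of_mul (right_ne_zero_of_mul hx'))
    (right_ne_zero_of_mul (right_ne_zero_of_mul hx')))

theorem trdeg_le_one_of_isParabolic [IsAlgClosed K] [CharZero K] (hX : IsClosed X)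
    (hirr : IsIrreducible X) (hreg : IsRegularAction X) (hpar : IsParabolic X) {i : ℤ} (hi : i ≠ 0)
    {f : coordRing X} (hf : f ∈ weightSpace X i) (hf0 : f ≠ 0) :
    Algebra.trdeg (invariantRing X) (coordRing X) ≤ 1 := by
  have := coordRing_isDomain hirr
  have hs := hpar.isSemidefinite hirr hreg
  obtain ⟨U, hU, ⟨u, hu⟩, -, hUd⟩ := hpar
  obtain ⟨v, hvu, hv⟩ := exists_basicOpen_subset hU hu
  have hv0 : v ≠ 0 := fun h => hvu (by rw [h]; rfl)
  have hA0 : IsNoetherianRing (invariantRing X) :=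
    isNoetherianRing_of_surjective _ _ (invariantProj hreg hs : coordRing X →+* invariantRing X)
      (invariantProj_surjective hreg hs)
  refine (trdeg_le_one_or_exists_infinite_values (K := K) (invariantRing X) (f := f)
    (mul_ne_zero hv0 hf0) fun c hc => ?_).resolve_right ?_
  · obtain ⟨x, hx⟩ := coordRing_exists_ne hc
    exact ⟨evalAt x, hx⟩
  rintro ⟨h, ψ, hψ⟩
  obtain ⟨c₀, χ₀, hχ₀, hχ₀f, -, hχ₀v⟩ := hψ.nonempty
  obtain ⟨x₀, hx₀⟩ := exists_evalAt_eq hX χ₀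
  have hx₀v : v.1 x₀ * f.1 x₀ ≠ 0 := by rwa [hx₀] at hχ₀v
  -- The points found share the limit of `x₀`, hence its orbit. Equality of the nonzero values of
  -- `f` forces `t ^ i = 1`, so `h` takes finitely many values on them.
  have hfin : {t : Kˣ | t ^ i.natAbs = 1}.Finite := by
    have : NeZero i.natAbs := ⟨Int.natAbs_ne_zero.mpr hi⟩
    have : Finite (rootsOfUnity i.natAbs K) := inferInstance
    exact Set.toFinite (rootsOfUnity i.natAbs K : Set Kˣ)
  refine hψ ((hfin.image fun t => h.1 (t • x₀)).subset ?_)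
  rintro c ⟨χ, hχ, hχf, hχc, hχv⟩
  obtain ⟨x, hx⟩ := exists_evalAt_eq hX χ
  have hxv : v.1 x * f.1 x ≠ 0 := by rwa [hx] at hχv
  have hinv : ∀ a ∈ invariantRing X, a.1 x = a.1 x₀ := fun a ha => by
    rw [← hx, ← hx₀]
    exact (hχ ⟨a, ha⟩).trans (hχ₀ ⟨a, ha⟩).symm
  have hfx : f.1 x = f.1 x₀ := by rw [← hx, ← hx₀, hχf, hχ₀f]
  have horb : MulAction.orbit Kˣ x = MulAction.orbit Kˣ x₀ := by
    by_contra hne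
    obtain ⟨y, -, hy⟩ := exists_limit_point hX hreg hs x
    refine Set.disjoint_left.mp (hUd x (hv x (left_ne_zero_of_mul hxv)) x₀
      (hv x₀ (left_ne_zero_of_mul hx₀v)) hne) (mem_closure_orbit_of_degreeZero hreg hy)
      (mem_closure_orbit_of_degreeZero hreg fun a => ?_)
    rw [hy, hinv _ (degreeZero_mem hreg a)]
  obtain ⟨t, ht⟩ : x ∈ MulAction.orbit Kˣ x₀ := horb ▸ MulAction.mem_orbit_self x
  simp only at ht
  refine ⟨t, ?_, by rw [← hχc, hx, ← ht]⟩
  have h1 := hf t x₀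
  rw [ht, hfx] at h1
  have h2 : t ^ i = 1 :=
    Units.ext (mul_right_cancel₀ (right_ne_zero_of_mul hx₀v) ((one_mul _).trans h1)).symm
  rcases Int.natAbs_eq i with h | h
  · rw [h, zpow_natCast] at h2; exact h2
  · rw [h, zpow_neg, zpow_natCast, inv_eq_one] at h2; exact h2

theorem trdeg_invariantRing_of_isParabolic [IsAlgClosed K] [CharZero K] (hX : IsClosed X)
    (hirr : IsIrreducible X) (hreg : IsRegularAction X) (heff : FaithfulSMul Kˣ X)
    (hpar : IsParabolic X) :
    Algebra.trdeg K (invariantRing X) + 1 = Algebra.trdeg K (coordRing X) := by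
  have := coordRing_isDomain hirr
  obtain ⟨i, hi, f, hf, hf0⟩ := exists_weight_ne_zero hreg heff
  refine le_antisymm (trdeg_invariantRing_add_one_le hi hf hf0) ?_
  rw [← trdeg_invariantRing_add]
  gcongr
  exact trdeg_le_one_of_isParabolic hX hirr hreg hpar hi hf hf0

end Parabolic

/-! ### Ratios of functions of equal weight. -/

theorem isAlgebraic_div_of_homogeneous {B A : Type u} {F : Type*} [CommRing B] [IsDomain B]
    [CommRing A] [IsDomain A] [Algebra B A] [FaithfulSMul B A] [Field F] [Algebra A F]
    [FaithfulSMul A F] [Algebra B F] [IsScalarTower B A F] (htr : Algebra.trdeg B A ≤ 1) {M N : A}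
    (hM : M ≠ 0)
    (hhom : ∀ (s : Finset (Fin 2 →₀ ℕ)) (c : (Fin 2 →₀ ℕ) → B),
      ∑ m ∈ s, algebraMap B A (c m) * (M ^ m 0 * N ^ m 1) = 0 →
      ∀ d : ℕ, ∑ m ∈ s with m 0 + m 1 = d, algebraMap B A (c m) * (M ^ m 0 * N ^ m 1) = 0) :
    IsAlgebraic B (algebraMap A F N / algebraMap A F M) := by
  have hdep : ¬ AlgebraicIndependent B ![M, N] := by
    intro h
    have h1 := h.lift_cardinalMk_le_trdeg
    have h2 := h1.trans (Cardinal.lift_le.mpr htr)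
    norm_num at h2
  rw [algebraicIndependent_iff] at hdep
  push Not at hdep
  obtain ⟨P, hP, hP0⟩ := hdep
  obtain ⟨m₀, hm₀⟩ := MvPolynomial.ne_zero_iff.mp hP0
  rw [MvPolynomial.aeval_def, MvPolynomial.eval₂_eq'] at hP
  simp only [Fin.prod_univ_two, Matrix.cons_val_zero, Matrix.cons_val_one] at hP
  have hd := hhom _ _ hP (m₀ 0 + m₀ 1)
  set d := m₀ 0 + m₀ 1 with hd_def
  set S := {m ∈ P.support | m 0 + m 1 = d} with hS
  have hMF : algebraMap A F M ≠ 0 := by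
    rwa [Ne, map_eq_zero_iff _ (FaithfulSMul.algebraMap_injective A F)]
  -- Dehomogenize the degree `d` part of a relation between `M` and `N`. With the total degree
  -- fixed, the exponent of `N` determines `m`, so no coefficients merge.
  refine ⟨∑ m ∈ S, Polynomial.monomial (m 1) (P.coeff m), ?_, ?_⟩
  · intro h0
    have h1 := congrArg (Polynomial.coeff · (m₀ 1)) h0
    simp only [Polynomial.finsetSum_coeff, Polynomial.coeff_monomial, Polynomial.coeff_zero] at h1
    rw [Finset.sum_eq_single m₀] at h1
    · simp [hm₀] at h1
    · intro m hm hne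
      rw [if_neg]
      intro h
      apply hne
      have hm' := (Finset.mem_filter.mp hm).2
      ext i
      fin_cases i
      · change m 0 = m₀ 0
        omega
      · exact h
    · intro hm
      refine absurd ?_ hm
      rw [hS, Finset.mem_filter]
      exact ⟨MvPolynomial.mem_support_iff.mpr hm₀, rfl⟩
  · have h1 : algebraMap A F M ^ d * Polynomial.aeval (algebraMap A F N / algebraMap A F M)
        (∑ m ∈ S, Polynomial.monomial (m 1) (P.coeff m)) = 0 := by
      rw [← map_zero (algebraMap A F), ← hd, map_sum, map_sum, Finset.mul_sum]
      refine Finset.sum_congr rfl fun m hm => ?_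
      have hm' := (Finset.mem_filter.mp hm).2
      rw [Polynomial.aeval_monomial, ← hm', map_mul, map_mul, map_pow, map_pow,
        ← IsScalarTower.algebraMap_apply, pow_add, div_pow]
      field_simp
    exact (mul_eq_zero.mp h1).resolve_left (pow_ne_zero _ hMF)

section Parabolic

variable {K : Type u} [Field K] [CharZero K] {n : ℕ} {X : Set (AffSpace K n)} [MulAction Kˣ X]

theorem weight_sum_filter_eq_zero {k : ℤ} (hk : k ≠ 0) {M N : coordRing X}
    (hM : M ∈ weightSpace X k) (hN : N ∈ weightSpace X k) (s : Finset (Fin 2 →₀ ℕ))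
    (c : (Fin 2 →₀ ℕ) → invariantRing X)
    (h : ∑ m ∈ s, algebraMap (invariantRing X) (coordRing X) (c m) * (M ^ m 0 * N ^ m 1) = 0)
    (d : ℕ) : ∑ m ∈ s with m 0 + m 1 = d,
      algebraMap (invariantRing X) (coordRing X) (c m) * (M ^ m 0 * N ^ m 1) = 0 := by
  classical
  set T := s.image fun m => m 0 + m 1 with hT
  have hw : Function.Injective fun j : ℕ => (j : ℤ) * k := fun a b hab => by
    simpa [hk] using hab
  have hmem : ∀ j ∈ T, ∑ m ∈ s with m 0 + m 1 = j,
      algebraMap (invariantRing X) (coordRing X) (c m) * (M ^ m 0 * N ^ m 1) ∈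
        weightSpace X ((j : ℤ) * k) := by
    intro j _
    refine Submodule.sum_mem _ fun m hm => ?_
    have hm' := (Finset.mem_filter.mp hm).2
    have h1 := SetLike.mul_mem_graded (A := weightSpace X)
      (mem_invariantRing_iff_mem_weightSpace_zero.mp (c m).2)
      (SetLike.mul_mem_graded (A := weightSpace X) (SetLike.pow_mem_graded (m 0) hM)
        (SetLike.pow_mem_graded (m 1) hN))
    have h2 : (0 : ℤ) + ((m 0) • k + (m 1) • k) = (j : ℤ) * k := by
      rw [← hm']; push_cast; simp only [nsmul_eq_mul]; ring
    rw [h2] at h1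
    exact h1
  by_cases hd : d ∈ T
  · refine weight_independent hw T hmem ?_ d hd
    rw [Finset.sum_fiberwise_of_maps_to (fun m hm => Finset.mem_image_of_mem _ hm)]
    exact h
  · refine Finset.sum_eq_zero fun m hm => ?_
    obtain ⟨h1, h2⟩ := Finset.mem_filter.mp hm
    exact absurd (h2 ▸ Finset.mem_image_of_mem _ h1) hd

theorem mem_invariantRing_of_mul_mem [IsDomain (coordRing X)] (hreg : IsRegularAction X) {k : ℤ}
    {p M : coordRing X} (hM : M ∈ weightSpace X k) (hM0 : M ≠ 0) (h : p * M ∈ weightSpace X k) :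
    p ∈ invariantRing X := by
  let := weightGrading hreg
  have h1 := DirectSum.coe_decompose_mul_add_of_right_mem (weightSpace X) (i := 0) (a := p) hM
  rw [zero_add, DirectSum.decompose_of_mem_same _ h] at h1
  rw [mul_right_cancel₀ hM0 h1]
  exact mem_invariantRing_iff_mem_weightSpace_zero.mpr (DirectSum.decompose (weightSpace X) p 0).2

/-- For `k ≠ 0`, `N / M` is algebraic over `A₀`, so some invariant multiple `q N / M` is integral.
Normality puts it in `A`, and comparison of weights makes it invariant. -/
theorem exists_invariant_ratio [IsDomain (coordRing X)] (hnormal : IsIntegrallyClosed (coordRing X))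
    (hreg : IsRegularAction X) (htr : Algebra.trdeg (invariantRing X) (coordRing X) ≤ 1) {k : ℤ}
    {M N : coordRing X} (hM : M ∈ weightSpace X k) (hN : N ∈ weightSpace X k) (hM0 : M ≠ 0) :
    ∃ p ∈ invariantRing X, ∃ q ∈ invariantRing X, q ≠ 0 ∧ q * N = p * M := by
  by_cases hk : k = 0
  · subst hk
    exact ⟨N, mem_invariantRing_iff_mem_weightSpace_zero.mpr hN, M,
      mem_invariantRing_iff_mem_weightSpace_zero.mpr hM, hM0, mul_comm _ _⟩
  have halg := isAlgebraic_div_of_homogeneous (F := FractionRing (coordRing X)) htr hM0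
    (weight_sum_filter_eq_zero hk hM hN)
  obtain ⟨q, hq0, hq⟩ := halg.exists_integral_multiple
  obtain ⟨p, hp⟩ := IsIntegrallyClosed.algebraMap_eq_of_integral
    (IsIntegral.tower_top (A := coordRing X) hq)
  have hMF : algebraMap (coordRing X) (FractionRing (coordRing X)) M ≠ 0 := by
    rwa [Ne, map_eq_zero_iff _ (IsFractionRing.injective _ _)]
  have h1 : q.1 * N = p * M := by
    apply IsFractionRing.injective (coordRing X) (FractionRing (coordRing X))
    rw [map_mul, map_mul, hp, Algebra.smul_def,
      IsScalarTower.algebraMap_apply (invariantRing X) (coordRing X), mul_assoc,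
      div_mul_cancel₀ _ hMF]
    rfl
  refine ⟨p, mem_invariantRing_of_mul_mem hreg hM hM0 ?_, q.1, q.2,
    fun h => hq0 (Subtype.ext h), h1⟩
  rw [← h1]
  simpa using SetLike.mul_mem_graded (A := weightSpace X)
    (mem_invariantRing_iff_mem_weightSpace_zero.mp q.2) hN

end Parabolic

/-! ### Separation of generic orbits by invariants. -/

section Parabolic

variable {K : Type u} [Field K] {n : ℕ} {X : Set (AffSpace K n)} [MulAction Kˣ X]

/-- Differences of weights form a subgroup of `ℤ`, since `A` is a domain. Its generator need not be
a weight itself, only the weight of a fraction `h₁ / h₀`. -/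
theorem exists_weight_generator [IsDomain (coordRing X)] {k₀ : ℤ} (hk₀ : k₀ ≠ 0)
    {f₀ : coordRing X} (hf₀ : f₀ ∈ weightSpace X k₀) (hf₀0 : f₀ ≠ 0) :
    ∃ g : ℤ, g ≠ 0 ∧ (∀ k, ∀ f ∈ weightSpace X k, f ≠ 0 → ∃ e : ℤ, k = g * e) ∧
      ∃ i, ∃ h₁ ∈ weightSpace X (i + g), ∃ h₀ ∈ weightSpace X i, h₁ ≠ 0 ∧ h₀ ≠ 0 := by
  let S : AddSubgroup ℤ :=
    { carrier := {g | ∃ i, ∃ h₁ ∈ weightSpace X (i + g), ∃ h₀ ∈ weightSpace X i,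
        h₁ ≠ 0 ∧ h₀ ≠ 0}
      zero_mem' := ⟨0, 1, by simpa using SetLike.one_mem_graded (weightSpace X), 1,
        SetLike.one_mem_graded (weightSpace X), one_ne_zero, one_ne_zero⟩
      add_mem' := by
        rintro a b ⟨i, u, hu, v, hv, hu0, hv0⟩ ⟨j, u', hu', v', hv', hu0', hv0'⟩
        refine ⟨i + j, u * u', ?_, v * v', SetLike.mul_mem_graded hv hv', mul_ne_zero hu0 hu0',
          mul_ne_zero hv0 hv0'⟩
        rw [add_add_add_comm]
        exact SetLike.mul_mem_graded hu hu'
      neg_mem' := by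
        rintro a ⟨i, u, hu, v, hv, hu0, hv0⟩
        exact ⟨i + a, v, by simpa using hv, u, hu, hv0, hu0⟩ }
  obtain ⟨g, hg⟩ := Int.subgroup_cyclic S
  have hmem : ∀ k, ∀ f ∈ weightSpace X k, f ≠ 0 → ∃ e : ℤ, k = g * e := by
    intro k f hf hf0
    have h1 : k ∈ S := ⟨0, f, by simpa using hf, 1, SetLike.one_mem_graded (weightSpace X), hf0,
      one_ne_zero⟩
    rw [hg, AddSubgroup.mem_closure_singleton] at h1
    obtain ⟨e, he⟩ := h1
    exact ⟨e, by rw [← he, smul_eq_mul, mul_comm]⟩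
  have hgS : g ∈ S := by rw [hg]; exact AddSubgroup.subset_closure rfl
  refine ⟨g, ?_, hmem, hgS⟩
  rintro rfl
  obtain ⟨e, he⟩ := hmem k₀ f₀ hf₀ hf₀0
  exact hk₀ (by simpa using he)

variable [CharZero K]

/-- Up to an invariant factor, the weight functions are powers of one weight fraction. -/
theorem exists_generic_weight_ratio [IsDomain (coordRing X)]
    (hnormal : IsIntegrallyClosed (coordRing X)) (hreg : IsRegularAction X)
    (htr : Algebra.trdeg (invariantRing X) (coordRing X) ≤ 1) {g i e : ℤ} {h₁ h₀ : coordRing X}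
    (hh₁ : h₁ ∈ weightSpace X (i + g)) (hh₀ : h₀ ∈ weightSpace X i) (hh₁0 : h₁ ≠ 0)
    (hh₀0 : h₀ ≠ 0) {f : coordRing X} (hf : f ∈ weightSpace X (g * e)) :
    ∃ q : coordRing X, q ≠ 0 ∧ ∀ (x y : X) (t : Kˣ), (∀ a ∈ invariantRing X, a.1 x = a.1 y) →
      q.1 x ≠ 0 → h₀.1 x ≠ 0 → h₁.1 x ≠ 0 → h₀.1 y ≠ 0 → h₁.1 y ≠ 0 →
      ((t ^ g : Kˣ) : K) = (h₁.1 y / h₀.1 y) / (h₁.1 x / h₀.1 x) →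
      f.1 y = ((t ^ (g * e) : Kˣ) : K) * f.1 x := by
  -- The sign of `e` decides whether `f h₀ ^ m` is compared with `h₁ ^ m` or `f h₁ ^ m` with `h₀ ^
  -- m`; each pair has equal weight.
  obtain ⟨m, rfl | rfl⟩ := e.eq_nat_or_neg
  · have hN := SetLike.mul_mem_graded (A := weightSpace X) hf (SetLike.pow_mem_graded m hh₀)
    have hM := SetLike.pow_mem_graded (A := weightSpace X) m hh₁
    rw [show g * (m : ℤ) + m • i = m • (i + g) by simp only [nsmul_eq_mul]; ring] at hN
    obtain ⟨p, hp, q, hq, hq0, hqp⟩ :=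
      exists_invariant_ratio hnormal hreg htr hM hN (pow_ne_zero m hh₁0)
    refine ⟨q, hq0, fun x y t hxy hqx hx0 hx1 hy0 hy1 ht => ?_⟩
    have hex : q.1 x * (f.1 x * h₀.1 x ^ m) = p.1 x * h₁.1 x ^ m :=
      congrFun (congrArg Subtype.val hqp) x
    have hey : q.1 y * (f.1 y * h₀.1 y ^ m) = p.1 y * h₁.1 y ^ m :=
      congrFun (congrArg Subtype.val hqp) y
    rw [← hxy q hq, ← hxy p hp] at hey
    rw [zpow_mul, Units.val_zpow_eq_zpow_val, ht, zpow_natCast]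
    have hex' : f.1 x = p.1 x * h₁.1 x ^ m / (q.1 x * h₀.1 x ^ m) := by
      rw [eq_div_iff (mul_ne_zero hqx (pow_ne_zero _ hx0)), ← hex]; ring
    have hey' : f.1 y = p.1 x * h₁.1 y ^ m / (q.1 x * h₀.1 y ^ m) := by
      rw [eq_div_iff (mul_ne_zero hqx (pow_ne_zero _ hy0)), ← hey]; ring
    rw [hex', hey']
    simp only [div_pow]
    field_simp
  · have hN := SetLike.mul_mem_graded (A := weightSpace X) hf (SetLike.pow_mem_graded m hh₁)
    have hM := SetLike.pow_mem_graded (A := weightSpace X) m hh₀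
    rw [show g * (-m : ℤ) + m • (i + g) = m • i by simp only [nsmul_eq_mul]; ring] at hN
    obtain ⟨p, hp, q, hq, hq0, hqp⟩ :=
      exists_invariant_ratio hnormal hreg htr hM hN (pow_ne_zero m hh₀0)
    refine ⟨q, hq0, fun x y t hxy hqx hx0 hx1 hy0 hy1 ht => ?_⟩
    have hex : q.1 x * (f.1 x * h₁.1 x ^ m) = p.1 x * h₀.1 x ^ m :=
      congrFun (congrArg Subtype.val hqp) x
    have hey : q.1 y * (f.1 y * h₁.1 y ^ m) = p.1 y * h₀.1 y ^ m :=
      congrFun (congrArg Subtype.val hqp) y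
    rw [← hxy q hq, ← hxy p hp] at hey
    rw [zpow_mul, Units.val_zpow_eq_zpow_val, ht, zpow_neg, zpow_natCast]
    have hex' : f.1 x = p.1 x * h₀.1 x ^ m / (q.1 x * h₁.1 x ^ m) := by
      rw [eq_div_iff (mul_ne_zero hqx (pow_ne_zero _ hx1)), ← hex]; ring
    have hey' : f.1 y = p.1 x * h₀.1 y ^ m / (q.1 x * h₁.1 y ^ m) := by
      rw [eq_div_iff (mul_ne_zero hqx (pow_ne_zero _ hy1)), ← hey]; ring
    rw [hex', hey']
    simp only [div_pow]
    field_simp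

theorem exists_generic_orbit_separation [IsAlgClosed K] [IsDomain (coordRing X)]
    (hnormal : IsIntegrallyClosed (coordRing X)) (hreg : IsRegularAction X)
    (htr : Algebra.trdeg (invariantRing X) (coordRing X) ≤ 1) {k₀ : ℤ} (hk₀ : k₀ ≠ 0)
    {f₀ : coordRing X} (hf₀ : f₀ ∈ weightSpace X k₀) (hf₀0 : f₀ ≠ 0) :
    ∃ v : coordRing X, v ≠ 0 ∧ ∀ x y : X, v.1 x ≠ 0 → v.1 y ≠ 0 →
      (∀ a ∈ invariantRing X, a.1 x = a.1 y) → y ∈ MulAction.orbit Kˣ x := by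
  obtain ⟨g, hg, hgen, i, h₁, hh₁, h₀, hh₀, hh₁0, hh₀0⟩ := exists_weight_generator hk₀ hf₀ hf₀0
  have key : ∀ k, ∀ f ∈ weightSpace X k, ∃ q : coordRing X, q ≠ 0 ∧ ∀ (x y : X) (t : Kˣ),
      (∀ a ∈ invariantRing X, a.1 x = a.1 y) →
      q.1 x ≠ 0 → h₀.1 x ≠ 0 → h₁.1 x ≠ 0 → h₀.1 y ≠ 0 → h₁.1 y ≠ 0 →
      ((t ^ g : Kˣ) : K) = (h₁.1 y / h₀.1 y) / (h₁.1 x / h₀.1 x) →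
      f.1 y = ((t ^ k : Kˣ) : K) * f.1 x := by
    intro k f hf
    by_cases hf0 : f = 0
    · subst hf0
      exact ⟨1, one_ne_zero, fun x y t _ _ _ _ _ _ _ => (mul_zero _).symm⟩
    · obtain ⟨e, rfl⟩ := hgen k f hf hf0
      exact exists_generic_weight_ratio hnormal hreg htr hh₁ hh₀ hh₁0 hh₀0 hf
  choose s c hc hsum using fun j => exists_sum_weights hreg (coordFun X j)
  choose q hq0 hq using fun (j : Fin n) (k : s j) => key k.1 (c j k.1) (hc j k.1 k.2)
  -- Finitely many denominators suffice: one for each weight component of each coordinate.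
  refine ⟨h₀ * h₁ * ∏ j, ∏ k, q j k, ?_, ?_⟩
  · exact mul_ne_zero (mul_ne_zero hh₀0 hh₁0)
      (Finset.prod_ne_zero_iff.mpr fun j _ => Finset.prod_ne_zero_iff.mpr fun k _ => hq0 j k)
  intro x y hx hy hxy
  rw [← evalAt_apply, map_mul, map_mul, mul_ne_zero_iff, mul_ne_zero_iff] at hx hy
  obtain ⟨⟨hx0, hx1⟩, hxq⟩ := hx
  obtain ⟨⟨hy0, hy1⟩, -⟩ := hy
  rw [map_prod, Finset.prod_ne_zero_iff] at hxq
  have hxq' : ∀ j k, (q j k).1 x ≠ 0 := fun j k => by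
    have h := hxq j (Finset.mem_univ j)
    rw [map_prod, Finset.prod_ne_zero_iff] at h
    exact h k (Finset.mem_univ k)
  rw [evalAt_apply] at hx0 hx1 hy0 hy1
  obtain ⟨t, ht⟩ := IsAlgClosed.exists_units_zpow_eq hg
    (Units.mk0 _ (div_ne_zero (div_ne_zero hy1 hy0) (div_ne_zero hx1 hx0)))
  refine ⟨t, eq_of_forall_coordFun fun j => ?_⟩
  simp only
  rw [← hsum j, sum_weight_apply_smul (w := id) (s j) (hc j), coordRing_coe_sum_apply]
  refine Finset.sum_congr rfl fun k hk => ?_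
  exact (hq j ⟨k, hk⟩ x y t hxy (hxq' j ⟨k, hk⟩) hx0 hx1 hy0 hy1 (by rw [ht]; rfl)).symm

theorem isParabolic_of_isSemidefinite [IsAlgClosed K] (hX : IsClosed X) (hirr : IsIrreducible X)
    (hnormal : IsIntegrallyClosed (coordRing X)) (hreg : IsRegularAction X)
    (heff : FaithfulSMul Kˣ X) (hs : IsSemidefinite X)
    (htr : Algebra.trdeg K (invariantRing X) + 1 = Algebra.trdeg K (coordRing X)) :
    IsParabolic X := by
  have := coordRing_isDomain hirr
  obtain ⟨k, hk, f, hf, hf0⟩ := exists_weight_ne_zero hreg heff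
  have htr' : Algebra.trdeg (invariantRing X) (coordRing X) ≤ 1 := by
    rw [← trdeg_invariantRing_add] at htr
    exact (Cardinal.eq_of_add_eq_add_left htr trdeg_invariantRing_lt_aleph0).ge
  obtain ⟨v, hv0, hv⟩ := exists_generic_orbit_separation hnormal hreg htr' hk hf hf0
  -- Where `v` is nonzero, invariants separate orbits. Where `f` is nonzero, points are not fixed,
  -- so their orbits miss their limit points.
  refine ⟨{x | (v * f).1 x ≠ 0}, isOpen_ne_zero _, coordRing_exists_ne (mul_ne_zero hv0 hf0),
    fun x hx hcl => ?_, fun x hx y hy hne => ?_⟩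
  · obtain ⟨y, hyfix, hy⟩ := exists_limit_point hX hreg hs x
    have h1 := mem_closure_orbit_of_degreeZero hreg hy
    rw [hcl.closure_eq] at h1
    obtain ⟨t, rfl⟩ := h1
    have h2 : x ∈ MulAction.fixedPoints Kˣ X := by
      have h3 := hyfix t⁻¹
      simp only [inv_smul_smul] at h3
      rw [h3]
      exact hyfix
    exact right_ne_zero_of_mul (show v.1 x * f.1 x ≠ 0 from hx)
      (weight_apply_eq_zero_of_fixed hk hf h2)
  · rw [Set.disjoint_left]
    intro z hzx hzy
    refine hne (MulAction.orbit_eq_iff.mpr ?_)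
    exact hv y x (left_ne_zero_of_mul (show v.1 y * f.1 y ≠ 0 from hy))
      (left_ne_zero_of_mul (show v.1 x * f.1 x ≠ 0 from hx)) fun a ha =>
        (invariant_apply_eq_of_mem_closure ha hzy).symm.trans
          (invariant_apply_eq_of_mem_closure ha hzx)

theorem hasNonnegGradingOfCorankOne_iff [IsAlgClosed K] (hX : IsClosed X) (hirr : IsIrreducible X)
    (hreg : IsRegularAction X) (hpos : ∃ i : ℤ, 0 < i ∧ weightSpace X i ≠ ⊥) :
    HasNonnegGradingOfCorankOne X ↔ IsSemidefinite X ∧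
      Algebra.trdeg K (invariantRing X) + 1 = Algebra.trdeg K (coordRing X) := by
  have := coordRing_isDomain hirr
  rw [HasNonnegGradingOfCorankOne, topologicalKrullDim_eq_trdeg hX hirr,
    toENat_add_one_eq_iff trdeg_invariantRing_lt_aleph0 trdeg_coordRing_lt_aleph0]
  refine and_congr_left fun _ => ?_
  constructor
  · intro hint
    have hneg : ∀ i : ℤ, i < 0 → ∀ f ∈ weightSpace X i, f = 0 := by
      intro i hi f hf
      have htop : f ∈ ⨆ j : ℕ, weightSpace X (j : ℤ) := by
        rw [hint.submodule_iSup_eq_top]; trivial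
      let := weightGrading hreg
      have hker : (⨆ j : ℕ, weightSpace X (j : ℤ)) ≤
          LinearMap.ker (GradedAlgebra.proj (weightSpace X) i) := by
        refine iSup_le fun j a ha => ?_
        exact DirectSum.decompose_of_mem_ne (weightSpace X) ha (by omega)
      have h1 : (DirectSum.decompose (weightSpace X) f i : coordRing X) = 0 := hker htop
      rwa [DirectSum.decompose_of_mem_same _ hf] at h1
    intro i hi f hf g hg
    rcases lt_or_gt_of_ne hi with h | h
    · rw [hneg i h f hf, zero_mul]
    · rw [hneg (-i) (by omega) g hg, mul_zero]
  · intro hs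
    obtain ⟨i, hi, hne⟩ := hpos
    obtain ⟨f, hf, hf0⟩ := Submodule.exists_mem_ne_zero_of_ne_bot hne
    have hneg : ∀ j : ℤ, j < 0 → ∀ g ∈ weightSpace X j, g = 0 := by
      intro j hj g hg
      by_contra hg0
      -- `f ^ |j|` and `g ^ |i|` have opposite nonzero weights; thus the positive weight from `hpos`
      -- excludes all negative ones.
      have h1 := SetLike.pow_mem_graded (A := weightSpace X) j.natAbs hf
      have h2 := SetLike.pow_mem_graded (A := weightSpace X) i.natAbs hg
      have h3 : i.natAbs • j = -(j.natAbs • i) := by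
        simp only [nsmul_eq_mul, Int.natCast_natAbs, abs_of_pos hi, abs_of_neg hj]
        ring
      rw [h3] at h2
      have h4 : j.natAbs • i ≠ 0 := by
        simp [hi.ne', hj.ne]
      exact mul_ne_zero (pow_ne_zero _ hf0) (pow_ne_zero _ hg0) (hs _ h4 _ h1 _ h2)
    refine DirectSum.isInternal_of_forall_sum
      (fun s _ hc h => weight_independent (w := fun j : ℕ => (j : ℤ)) Nat.cast_injective s hc h)
      fun a => ?_
    obtain ⟨s, c, hc, rfl⟩ := exists_sum_weights hreg a
    -- Components of negative weight are zero, so `toNat` only reindexes the remaining ones.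
    refine ⟨(s.filter (0 ≤ ·)).image Int.toNat, fun j => c j, fun j hj => ?_, ?_⟩
    · obtain ⟨k, hk, rfl⟩ := Finset.mem_image.mp hj
      obtain ⟨hks, hk0⟩ := Finset.mem_filter.mp hk
      simp only [Int.toNat_of_nonneg hk0]
      exact hc k hks
    · rw [Finset.sum_image, Finset.sum_filter]
      · refine Finset.sum_congr rfl fun k hk => ?_
        split_ifs with hk0
        · rw [Int.toNat_of_nonneg hk0]
        · exact (hneg k (not_le.mp hk0) _ (hc k hk)).symm
      · intro k hk l hl hkl
        have hk0 := (Finset.mem_filter.mp hk).2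
        have hl0 := (Finset.mem_filter.mp hl).2
        omega

end Parabolic

theorem lemma2p1 {K : Type*} [Field K] [IsAlgClosed K] [CharZero K] {n : ℕ}
    (X : Set (AffSpace K n)) (hclosed : IsClosed X) (hirr : IsIrreducible X)
    (hnormal : IsIntegrallyClosed (coordRing X))
    [MulAction Kˣ X] (hreg : IsRegularAction X) (heff : FaithfulSMul Kˣ X) :
    (IsParabolic X ↔ ∃ D : Set X, IsPrimeDivisor D ∧ IsPointwiseFixed D) ∧
    ((∃ i : ℤ, 0 < i ∧ weightSpace X i ≠ ⊥) →
      List.TFAE [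
        IsParabolic X,
        ∃ D : Set X, IsPrimeDivisor D ∧ IsPointwiseFixed D,
        HasNonnegGradingOfCorankOne X]) ∧
    ∀ D : Set X, IsPrimeDivisor D → IsPointwiseFixed D → D = MulAction.fixedPoints Kˣ X := by
  have hpar : IsParabolic X ↔ IsSemidefinite X ∧
      Algebra.trdeg K (invariantRing X) + 1 = Algebra.trdeg K (coordRing X) :=
    ⟨fun h => ⟨h.isSemidefinite hirr hreg,
      trdeg_invariantRing_of_isParabolic hclosed hirr hreg heff h⟩,
      fun h => isParabolic_of_isSemidefinite hclosed hirr hnormal hreg heff h.1 h.2⟩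
  have hdiv : (∃ D : Set X, IsPrimeDivisor D ∧ IsPointwiseFixed D) ↔ IsSemidefinite X ∧
      Algebra.trdeg K (invariantRing X) + 1 = Algebra.trdeg K (coordRing X) :=
    ⟨fun ⟨_, hD, hfix⟩ =>
      ⟨isSemidefinite_of_fixed_primeDivisor hclosed hirr hreg heff hD hfix,
        trdeg_invariantRing_of_fixed_primeDivisor hclosed hirr hreg heff hD hfix⟩,
      fun h => exists_fixed_primeDivisor hclosed hirr hreg h.1 h.2⟩
  refine ⟨hpar.trans hdiv.symm, fun hpos => ?_, fun D hD hfix =>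
    eq_fixedPoints_of_fixed_primeDivisor hclosed hirr hreg heff hD hfix⟩
  have hgr := hasNonnegGradingOfCorankOne_iff hclosed hirr hreg hpos
  tfae_have 1 ↔ 2 := hpar.trans hdiv.symm
  tfae_have 1 ↔ 3 := hpar.trans hgr.symm
  tfae_finish
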